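/- **Setting.** A learner for $n\times m$ matrices is a (randomized) sequential algorithm: in each round, based on its own internal randomness and on the entries sampled and the values observed so far, it either samples an entry $(i,j)$ or stops and returns an entry. A sample of the entry $(i,j)$ of an unknown matrix $A\in[-1,1]^{n\times m}$ shows $A_{i,j}+\eta$ with a zero-mean $1$-sub-Gaussian noise $\eta$ (that is, $\mathbb{E}\,e^{s\eta}\le e^{s^2/2}$ for all $s\in\mathbb{R}$); the noises of all samples are independent. An entry $(i_*,j_*)$ is a strict pure strategy Nash equilibrium (PSNE) of $A$ if $A_{i,j_*}<A_{i_*,j_*}<A_{i_*,j}$ for all $i\neq i_*$ and all $j\neq j_*$. In this case let $$\mathbf{H}_1=\sum_{i\neq i_*}\frac{1}{(A_{i_*,j_*}-A_{i,j_*})^2}+\sum_{j\neq j_*}\frac{1}{(A_{i_*,j}-A_{i_*,j_*})^2}.$$ **Theorem.** There are an absolute constant $c_0>0$ and an algorithm that is given only $n,m\ge 1$ and $\delta\in(0,1)$ such that the following holds. 1. For every $A\in[-1,1]^{n\times m}$ with a strict PSNE $(i_*,j_*)$ and every noise as above, with probability at least $1-\delta$ the algorithm takes at most $$c_0\cdot\mathbf{H}_1\cdot\log\left(\frac{nm\,\max\{1,\log\mathbf{H}_1\}}{\delta}\right)\cdot\log(nm)$$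 samples from $A$ and returns $(i_*,j_*)$. (For $n=m=1$ we have $\mathbf{H}_1=0$, and the bound is read as $0$.) 2. (Dueling bandits.) Let $\mathbf{P}\in[0,1]^{K\times K}$ with $\mathbf{P}_{i,j}+\mathbf{P}_{j,i}=1$ for all $i,j$, let a sample of $(i,j)$ be an independent duel, with outcome $1$ (arm $i$ wins) with probability $\mathbf{P}_{i,j}$ and $0$ otherwise, and let $i_*$ be a Condorcet winner, that is, $\mathbf{P}_{i_*,j}>1/2$ for all $j\neq i_*$. Let $\mathbf{H}=\sum_{i\neq i_*}(\mathbf{P}_{i_*,i}-1/2)^{-2}$. Then the same algorithm, run with $n=m=K$, with probability at least $1-\delta$ takes at most $$c_0\cdot\mathbf{H}\cdot\log\left(\frac{K\log\mathbf{H}}{\delta}\right)\cdot\log K$$ duels (read as $0$ for $K=1$) and returns $(i_*,i_*)$. -/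

import Mathlib

open MeasureTheory ProbabilityTheory

universe u

/-- A randomized sequential sampling algorithm for `n × m` matrices.  It draws an internal random
seed once, and then repeatedly looks at its history (the list of the sampled entries with the values
observed there, most recent first) and either samples an entry (`Sum.inl`) or stops and returns an
entry (`Sum.inr`).  It has no access to the matrix or to the noise except through the history. -/
structure Learner (n m : ℕ) where
  /-- the space of internal random seeds -/
  Seed : Type
  [measurableSpaceSeed : MeasurableSpace Seed]
  /-- the law of the internal random seed -/
  law : Measure Seed
  [isProbabilityMeasure_law : IsProbabilityMeasure law]
  /-- the next action, given the seed and the history -/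
  act : Seed → List ((Fin n × Fin m) × ℝ) → (Fin n × Fin m) ⊕ (Fin n × Fin m)
  measurable_act : ∀ t : ℕ,
    Measurable fun p : Seed × (Fin t → (Fin n × Fin m) × ℝ) => act p.1 (List.ofFn p.2)

attribute [instance] Learner.measurableSpaceSeed Learner.isProbabilityMeasure_law

namespace Learner

variable {n m : ℕ}

/-- The history after `t` rounds, when the seed is `s` and the `k`-th sample taken from entry `a`
(`k = 0, 1, …`) has the value `x a k`.  The history does not change any more once the learner has
stopped, so that its length is the number of samples taken so far. -/
def history (L : Learner n m) (s : L.Seed) (x : Fin n × Fin m → ℕ → ℝ) :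
    ℕ → List ((Fin n × Fin m) × ℝ)
  | 0 => []
  | t + 1 =>
    match L.act s (L.history s x t) with
    | Sum.inl a =>
      (a, x a (((L.history s x t).map Prod.fst).count a)) :: L.history s x t
    | Sum.inr _ => L.history s x t

/-- The learner stops after at most `N` samples, and returns the entry `b`. -/
def ReturnsWithin (L : Learner n m) (s : L.Seed) (x : Fin n × Fin m → ℕ → ℝ)
    (b : Fin n × Fin m) (N : ℝ) : Prop :=
  ∃ t : ℕ, L.act s (L.history s x t) = Sum.inr b ∧ ((L.history s x t).length : ℝ) ≤ N

/-- The probability, over the samples and the independent internal randomness of the learner, that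
the learner stops after at most `N` samples and returns `b`. -/
noncomputable def probReturnsWithin (L : Learner n m) {Ω : Type*} [MeasurableSpace Ω]
    (μ : Measure Ω) (X : Fin n × Fin m → ℕ → Ω → ℝ) (b : Fin n × Fin m) (N : ℝ) : ℝ :=
  (μ.prod L.law).real {p : Ω × L.Seed | L.ReturnsWithin p.2 (fun a k => X a k p.1) b N}

end Learner

/-- `X a k` is the `k`-th sample of entry `a` of the matrix `A`: the samples are independent, and
each of them is the entry plus a zero-mean `1`-sub-Gaussian noise. -/
structure IsNoisySampling {n m : ℕ} (A : Matrix (Fin n) (Fin m) ℝ) {Ω : Type*} [MeasurableSpace Ω]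
    (μ : Measure Ω) (X : Fin n × Fin m → ℕ → Ω → ℝ) : Prop where
  measurable : ∀ a k, Measurable (X a k)
  indep : iIndepFun (fun p : (Fin n × Fin m) × ℕ => X p.1 p.2) μ
  mean : ∀ a k, ∫ ω, (X a k ω - A a.1 a.2) ∂μ = 0
  subGaussian : ∀ a k, HasSubgaussianMGF (fun ω => X a k ω - A a.1 a.2) 1 μ

/-- `(i₀, j₀)` is a strict pure strategy Nash equilibrium of `A`: the unique highest entry of its
column and the unique lowest entry of its row. -/
def IsStrictPSNE {n m : ℕ} (A : Matrix (Fin n) (Fin m) ℝ) (i₀ : Fin n) (j₀ : Fin m) : Prop :=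
  (∀ i, i ≠ i₀ → A i j₀ < A i₀ j₀) ∧ ∀ j, j ≠ j₀ → A i₀ j₀ < A i₀ j

/-- The sum of the inverse squared gaps over the row and the column of `(i₀, j₀)`. -/
noncomputable def hardness {n m : ℕ} (A : Matrix (Fin n) (Fin m) ℝ) (i₀ : Fin n) (j₀ : Fin m) : ℝ :=
  ∑ i ∈ Finset.univ.erase i₀, 1 / (A i₀ j₀ - A i j₀) ^ 2
    + ∑ j ∈ Finset.univ.erase j₀, 1 / (A i₀ j - A i₀ j₀) ^ 2

/-- `P` is the preference matrix of a dueling bandit with `K` arms: `P i j` is the probability that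
arm `i` wins a duel against arm `j`. -/
def IsPreferenceMatrix {K : ℕ} (P : Matrix (Fin K) (Fin K) ℝ) : Prop :=
  (∀ i j, P i j ∈ Set.Icc (0 : ℝ) 1) ∧ ∀ i j, P i j + P j i = 1

/-- `X (i, j) k` is the outcome of the `k`-th duel of arm `i` against arm `j`: `1` if `i` wins and
`0` if `j` wins.  The duels are independent, and `i` wins with probability `P i j`. -/
structure IsDuelSampling {K : ℕ} (P : Matrix (Fin K) (Fin K) ℝ) {Ω : Type*} [MeasurableSpace Ω]
    (μ : Measure Ω) (X : Fin K × Fin K → ℕ → Ω → ℝ) : Prop where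
  measurable : ∀ a k, Measurable (X a k)
  indep : iIndepFun (fun p : (Fin K × Fin K) × ℕ => X p.1 p.2) μ
  outcome : ∀ a k ω, X a k ω = 0 ∨ X a k ω = 1
  prob : ∀ a k, μ.real {ω | X a k ω = 1} = P a.1 a.2

/-- Arm `i₀` is a Condorcet winner: it beats any other arm with probability greater than `1/2`. -/
def IsCondorcetWinner {K : ℕ} (P : Matrix (Fin K) (Fin K) ℝ) (i₀ : Fin K) : Prop :=
  ∀ j, j ≠ i₀ → 1 / 2 < P i₀ j

/-- The sum of the inverse squared gaps of the arms to the arm `i₀`. -/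
noncomputable def duelHardness {K : ℕ} (P : Matrix (Fin K) (Fin K) ℝ) (i₀ : Fin K) : ℝ :=
  ∑ i ∈ Finset.univ.erase i₀, 1 / (P i₀ i - 1 / 2) ^ 2

/-! Let V be the value of `A` at the equilibrium `(i₀, j₀)`. Row `i₀` has no entry below V and
column `j₀` none above V; the other entries are arbitrary. The algorithm works in phases of accuracy
w, where w starts at 2 and shrinks by the factor 3/4. It maintains an interval of length w around V,
and lists R, S of rows and columns that contain `i₀`, `j₀` and are at most about twice as long as
the numbers of rows and columns with gap below 5w.

The interval is narrowed by a walk (`failure_compareValue_le`): test an entry in a remaining row and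
column against the midpoint, and drop the column if it is high and the row if it is low. Column `j₀`
can be dropped only if V is high, and row `i₀` only if V is low, so the list that runs out first
decides the comparison after at most |R| + |S| tests.

The lists are shortened by random sampling. If `i₀` were known, columns far above V in row `i₀`
could be discarded. But any rows with many entries above V serve instead: keep the rows that look so
on random columns, which includes `i₀` while at least half of the columns are far, then discard the
columns where a noticeable share of the kept rows lies above V. Column `j₀` survives whichever rows
were kept, and double counting (`List.seven_mul_countP_sparse_le`) leaves at most 6/7 of the
columns. Each row and column needs only a few crude tests, so a round costs |R| + |S| rather than
|R||S|, and O(log(nm)) rounds suffice (`failure_eliminateRounds_le`). Rows are treated dually.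

A row or column of gap g is paid for only while g < 5w, about 1/w² each time; this geometric sum is
O(1/g²), and all gaps together give H₁ (`sum_near_mul_samples_le`). The other factors are the
repetitions, logarithmic in nm(r + 2)/δ in phase r, and the rounds. There are O(max(1, log H₁))
phases, which is the source of the iterated logarithm.

The algorithm is a decision tree, analysed with a worst-case expectation that knows only tail bounds
(`upperExp`). `measureReal_not_le_failure` transfers this to actual samples by independence, and
`returnsWithin_ofStrategies` turns the trees into a learner. For duels, a Condorcet winner is an
equilibrium on the diagonal and H₁ = 2H. -/

/-! ### Decision trees and their worst-case expectation. -/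

/-- A finite sampling strategy with result in `α`: `test e N θ k` takes `N` samples of the entry `e`
and branches on whether their average is at least `θ`, and `flip n k` branches on a uniformly
random element of `Fin (n + 1)`. -/
inductive Strategy (E α : Type) : Type
  | ret (a : α) : Strategy E α
  | test (e : E) (N : ℕ) (θ : ℝ) (k : Bool → Strategy E α) : Strategy E α
  | flip (n : ℕ) (k : Fin (n + 1) → Strategy E α) : Strategy E α

/-- An upper bound for the probability that the average of `N` independent samples with mean `v`
and `1`-sub-Gaussian noise is at least `θ`. -/
noncomputable def tailUpper (v : ℝ) (N : ℕ) (θ : ℝ) : ℝ :=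
  if v < θ then Real.exp (-(N * (θ - v) ^ 2 / 2)) else 1

/-- A lower bound for the probability that the average of `N` independent samples with mean `v`
and `1`-sub-Gaussian noise is at least `θ`. -/
noncomputable def tailLower (v : ℝ) (N : ℕ) (θ : ℝ) : ℝ :=
  if θ < v then 1 - Real.exp (-(N * (v - θ) ^ 2 / 2)) else 0

lemma tailUpper_nonneg (v : ℝ) (N : ℕ) (θ : ℝ) : 0 ≤ tailUpper v N θ := by
  unfold tailUpper; split_ifs <;> positivity

lemma exp_neg_sq_le_one (N : ℕ) (x : ℝ) : Real.exp (-(N * x ^ 2 / 2)) ≤ 1 := by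
  rw [Real.exp_le_one_iff]
  have : 0 ≤ N * x ^ 2 / 2 := by positivity
  linarith

lemma tailUpper_le_one (v : ℝ) (N : ℕ) (θ : ℝ) : tailUpper v N θ ≤ 1 := by
  unfold tailUpper; split_ifs
  · exact exp_neg_sq_le_one _ _
  · exact le_rfl

lemma tailLower_nonneg (v : ℝ) (N : ℕ) (θ : ℝ) : 0 ≤ tailLower v N θ := by
  unfold tailLower; split_ifs
  · linarith [exp_neg_sq_le_one N (v - θ)]
  · exact le_rfl

lemma tailLower_le_one (v : ℝ) (N : ℕ) (θ : ℝ) : tailLower v N θ ≤ 1 := by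
  unfold tailLower; split_ifs
  · linarith [Real.exp_pos (-(N * (v - θ) ^ 2 / 2))]
  · exact zero_le_one

namespace Strategy

variable {E α β : Type}

/-- Run a strategy, and continue with a strategy that depends on its result. -/
def bind : Strategy E α → (α → Strategy E β) → Strategy E β
  | ret a, g => g a
  | test e N θ k, g => test e N θ fun b => (k b).bind g
  | flip n k, g => flip n fun i => (k i).bind g

/-- The largest expectation of `f (result) (number of samples)` that is compatible with the tail
bounds for samples of a matrix with the entries `A`. -/
noncomputable def upperExp (A : E → ℝ) : Strategy E α → (α → ℕ → ℝ) → ℝ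
  | ret a, f => f a 0
  | test e N θ k, f =>
    max (tailUpper (A e) N θ * upperExp A (k true) (fun a c => f a (N + c))
        + (1 - tailUpper (A e) N θ) * upperExp A (k false) (fun a c => f a (N + c)))
      (tailLower (A e) N θ * upperExp A (k true) (fun a c => f a (N + c))
        + (1 - tailLower (A e) N θ) * upperExp A (k false) (fun a c => f a (N + c)))
  | flip n k, f => (∑ i, upperExp A (k i) f) / (n + 1)

variable (A : E → ℝ)

/-- The tower property is an equality because the maximum is taken separately at each node of the
tree. -/
lemma upperExp_bind (P : Strategy E α) (g : α → Strategy E β) (f : β → ℕ → ℝ) :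
    (P.bind g).upperExp A f
      = P.upperExp A (fun a c => (g a).upperExp A (fun b c' => f b (c + c'))) := by
  induction P generalizing f with
  | ret a => simp [bind, upperExp]
  | test e N θ k ih => simp only [bind, upperExp, ih, add_assoc]
  | flip n k ih => simp only [bind, upperExp, ih]

variable {A}

lemma convexComb_mono {q x y x' y' : ℝ} (h0 : 0 ≤ q) (h1 : q ≤ 1) (hx : x ≤ x') (hy : y ≤ y') :
    q * x + (1 - q) * y ≤ q * x' + (1 - q) * y' :=
  add_le_add (mul_le_mul_of_nonneg_left hx h0) (mul_le_mul_of_nonneg_left hy (by linarith))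

lemma upperExp_mono (P : Strategy E α) {f g : α → ℕ → ℝ} (h : ∀ a c, f a c ≤ g a c) :
    P.upperExp A f ≤ P.upperExp A g := by
  induction P generalizing f g with
  | ret a => exact h a 0
  | test e N θ k ih =>
    have h' : ∀ b, (k b).upperExp A (fun a c => f a (N + c))
        ≤ (k b).upperExp A (fun a c => g a (N + c)) := fun b => ih b fun a c => h a _
    exact max_le_max
      (convexComb_mono (tailUpper_nonneg _ _ _) (tailUpper_le_one _ _ _) (h' _) (h' _))
      (convexComb_mono (tailLower_nonneg _ _ _) (tailLower_le_one _ _ _) (h' _) (h' _))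
  | flip n k ih =>
    simp only [upperExp]
    gcongr with i
    exact ih i h

lemma upperExp_const (P : Strategy E α) (x : ℝ) : P.upperExp A (fun _ _ => x) = x := by
  induction P with
  | ret a => rfl
  | test e N θ k ih => simp only [upperExp, ih]; ring_nf; simp
  | flip n k ih =>
    simp only [upperExp, ih, Finset.sum_const, Finset.card_univ, Fintype.card_fin, nsmul_eq_mul]
    push_cast; field_simp

/-- Only subadditive: the two summands may prefer different endpoints at the same test. -/
lemma upperExp_add_le (P : Strategy E α) (f g : α → ℕ → ℝ) :
    P.upperExp A (fun a c => f a c + g a c) ≤ P.upperExp A f + P.upperExp A g := by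
  induction P generalizing f g with
  | ret a => exact le_rfl
  | test e N θ k ih =>
    have h' := fun b => ih b (fun a c => f a (N + c)) (fun a c => g a (N + c))
    refine max_le ?_ ?_
    · refine (convexComb_mono (tailUpper_nonneg _ _ _) (tailUpper_le_one _ _ _)
        (h' true) (h' false)).trans ?_
      refine le_trans (le_of_eq ?_) (add_le_add (le_max_left _ _) (le_max_left _ _))
      ring
    · refine (convexComb_mono (tailLower_nonneg _ _ _) (tailLower_le_one _ _ _)
        (h' true) (h' false)).trans ?_
      refine le_trans (le_of_eq ?_) (add_le_add (le_max_right _ _) (le_max_right _ _))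
      ring
  | flip n k ih =>
    simp only [upperExp]
    rw [← add_div, ← Finset.sum_add_distrib]
    gcongr with i
    exact ih i f g

lemma upperExp_const_mul (P : Strategy E α) {x : ℝ} (hx : 0 ≤ x) (f : α → ℕ → ℝ) :
    P.upperExp A (fun a c => x * f a c) = x * P.upperExp A f := by
  induction P generalizing f with
  | ret a => rfl
  | test e N θ k ih =>
    simp only [upperExp, ih]
    rw [mul_max_of_nonneg _ _ hx]
    congr 1 <;> ring
  | flip n k ih =>
    simp only [upperExp, ih, ← Finset.mul_sum]
    ring

open Classical in
/-- An upper bound for the probability that the result and the number of samples violate `p`. -/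
noncomputable def failure (A : E → ℝ) (P : Strategy E α) (p : α → ℕ → Prop) : ℝ :=
  P.upperExp A (fun a c => if p a c then 0 else 1)

lemma failure_eq_upperExp (P : Strategy E α) (p : α → ℕ → Prop) [∀ a c, Decidable (p a c)] :
    P.failure A p = P.upperExp A (fun a c => if p a c then 0 else 1) := by
  unfold failure
  congr 1
  funext a c
  split_ifs <;> rfl

lemma failure_nonneg (P : Strategy E α) (p : α → ℕ → Prop) : 0 ≤ P.failure A p := by
  rw [← upperExp_const (A := A) P 0]
  exact upperExp_mono P fun a c => by split_ifs <;> norm_num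

lemma failure_le_one (P : Strategy E α) (p : α → ℕ → Prop) : P.failure A p ≤ 1 := by
  rw [← upperExp_const (A := A) P 1]
  exact upperExp_mono P fun a c => by split_ifs <;> norm_num

lemma failure_mono (P : Strategy E α) {p q : α → ℕ → Prop} (h : ∀ a c, p a c → q a c) :
    P.failure A q ≤ P.failure A p := by
  refine upperExp_mono P fun a c => ?_
  by_cases hp : p a c
  · simp [hp, h a c hp]
  · simp only [hp, if_false]; split_ifs <;> norm_num

lemma failure_and_le (P : Strategy E α) (p q : α → ℕ → Prop) :
    P.failure A (fun a c => p a c ∧ q a c) ≤ P.failure A p + P.failure A q := by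
  refine le_trans (upperExp_mono P fun a c => ?_) (upperExp_add_le P _ _)
  by_cases hp : p a c <;> by_cases hq : q a c <;> simp [hp, hq]

lemma failure_ret_le {a : α} {p : α → ℕ → Prop} (h : p a 0) :
    (ret a : Strategy E α).failure A p ≤ 0 := by
  simp [failure, upperExp, h]

/-- Union bound for two stages: either the first one misses `p`, or the second one fails after `p`.
The samples `c` already spent are carried along, so that cost bounds add up. -/
lemma failure_bind_le {P : Strategy E α} {g : α → Strategy E β} {p : α → ℕ → Prop}
    {q : β → ℕ → Prop} {x y : ℝ} (hP : P.failure A p ≤ x) (hy : 0 ≤ y)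
    (hg : ∀ a c, p a c → (g a).failure A (fun b c' => q b (c + c')) ≤ y) :
    (P.bind g).failure A q ≤ x + y := by
  unfold failure
  rw [upperExp_bind]
  calc _ ≤ P.upperExp A (fun a c => (open Classical in if p a c then (0 : ℝ) else 1) + y) := by
        refine upperExp_mono P fun a c => ?_
        by_cases h : p a c
        · simpa [h, failure] using hg a c h
        · simp only [h, if_false]
          exact (failure_le_one (g a) (fun b c' => q b (c + c'))).trans (by linarith)
    _ ≤ P.failure A p + P.upperExp A (fun _ _ => y) := upperExp_add_le P _ _
    _ ≤ x + y := by rw [upperExp_const]; linarith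

/-- At most one outcome is wrong, so only the tail of that outcome is charged. -/
lemma failure_test_le {e : E} {N : ℕ} {θ x : ℝ} {g : Bool → α} {p : α → Prop} (hx : 0 ≤ x)
    (h : p (g true) ∨ p (g false))
    (ht : ¬ p (g true) → tailUpper (A e) N θ ≤ x)
    (hf : ¬ p (g false) → 1 - tailLower (A e) N θ ≤ x) :
    (test e N θ fun b => ret (g b)).failure A (fun a c => p a ∧ c ≤ N) ≤ x := by
  have hul : tailLower (A e) N θ ≤ tailUpper (A e) N θ := by
    have := tailUpper_nonneg (A e) N θ
    have := tailLower_le_one (A e) N θ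
    unfold tailLower tailUpper at *
    split_ifs at * with h1 h2 h2 <;> linarith
  simp only [failure, upperExp]
  by_cases h1 : p (g true) <;> by_cases h2 : p (g false)
  · rw [if_pos ⟨h1, le_rfl⟩, if_pos ⟨h2, le_rfl⟩]
    apply max_le <;> linarith
  · have := hf h2
    rw [if_pos ⟨h1, le_rfl⟩, if_neg fun h => h2 h.1]
    apply max_le <;> linarith
  · have := ht h1
    rw [if_neg fun h => h1 h.1, if_pos ⟨h2, le_rfl⟩]
    apply max_le <;> linarith
  · tauto

/-! ### Random draws, Chernoff bounds and filtering. -/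

/-- Run `t b` for a uniformly random element `b` of the list. -/
def draw : List β → (β → Strategy E Bool) → Strategy E Bool
  | [], _ => ret false
  | b :: l, t => flip l.length fun i => t ((b :: l).get i)

/-- The number of successes among `T` runs of `d`. -/
def tally (d : Strategy E Bool) : ℕ → Strategy E ℕ
  | 0 => ret 0
  | T + 1 => d.bind fun b => (tally d T).bind fun n => ret (b.toNat + n)

/-- Check that fewer than `s` among `T` runs of `d` are successful. -/
def under (d : Strategy E Bool) (T s : ℕ) : Strategy E Bool :=
  (tally d T).bind fun n => ret (decide (n < s))

/-- Keep the elements of a list that pass a random test. -/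
def sift (p : β → Strategy E Bool) : List β → Strategy E (List β)
  | [] => ret []
  | b :: l => (p b).bind fun k => (sift p l).bind fun l' => ret (if k then b :: l' else l')

lemma sum_map_div_length_le (l : List β) (hl : l ≠ []) (f : β → ℝ) (bad : β → Prop)
    [DecidablePred bad] {x : ℝ} (h0 : 0 ≤ x) (h1 : ∀ b ∈ l, f b ≤ 1)
    (h : ∀ b ∈ l, ¬ bad b → f b ≤ x) :
    (l.map f).sum / l.length ≤ (l.countP fun b => bad b) / (l.length : ℝ) + x := by
  have hpos : (0 : ℝ) < l.length := by exact_mod_cast List.length_pos_iff.2 hl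
  rw [div_add' _ _ _ hpos.ne', div_le_div_iff_of_pos_right hpos]
  clear hl hpos
  induction l with
  | nil => simp
  | cons b l ih =>
    have ih := ih (fun b hb => h1 b (List.mem_cons_of_mem _ hb))
      (fun b hb => h b (List.mem_cons_of_mem _ hb))
    have hb := h b List.mem_cons_self
    have hb1 := h1 b List.mem_cons_self
    simp only [List.map_cons, List.sum_cons, List.length_cons, List.countP_cons]
    by_cases hg : bad b
    · simp only [hg, decide_true, if_true]
      push_cast
      linarith
    · have := hb hg
      simp only [hg, decide_false, Bool.false_eq_true, if_false]
      push_cast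
      linarith

lemma failure_draw_eq (l : List β) (hl : l ≠ []) (t : β → Strategy E Bool) (p : Bool → ℕ → Prop) :
    (draw l t).failure A p = (l.map fun b => (t b).failure A p).sum / l.length := by
  cases l with
  | nil => exact absurd rfl hl
  | cons b l =>
    simp only [draw, failure, upperExp]
    congr 1
    · exact Fin.sum_univ_fun_getElem (b :: l)
        (fun b => (t b).upperExp A fun a c => open Classical in if p a c then (0 : ℝ) else 1)
    · simp

/-- Average over the drawn element: bad elements are charged 1, the others `x`. -/
lemma failure_draw_le {l : List β} (hl : l ≠ []) {t : β → Strategy E Bool} {p : Bool → ℕ → Prop}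
    (bad : β → Prop) [DecidablePred bad] {x : ℝ} (hx : 0 ≤ x)
    (h : ∀ b ∈ l, ¬ bad b → (t b).failure A p ≤ x) :
    (draw l t).failure A p ≤ (l.countP fun b => bad b) / (l.length : ℝ) + x := by
  rw [failure_draw_eq l hl]
  exact sum_map_div_length_le l hl _ bad hx (fun b _ => failure_le_one _ _) h

lemma failure_draw_cost {l : List β} {t : β → Strategy E Bool} {C : ℕ}
    (h : ∀ b ∈ l, (t b).failure A (fun _ c => c ≤ C) ≤ 0) :
    (draw l t).failure A (fun _ c => c ≤ C) ≤ 0 := by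
  by_cases hl : l = []
  · subst hl
    exact failure_ret_le (Nat.zero_le _)
  · have := failure_draw_le (p := fun _ c => c ≤ C) hl (fun _ => False) le_rfl (fun b hb _ => h b hb)
    simpa using this

/-- The generating function of the tally is submultiplicative over runs; with Markov's inequality
this yields both Chernoff bounds below. -/
lemma upperExp_tally_le {d : Strategy E Bool} {x F : ℝ} (hx : 0 ≤ x)
    (hd : d.upperExp A (fun b _ => x ^ b.toNat) ≤ F) (hF : 0 ≤ F) (T : ℕ) :
    (tally d T).upperExp A (fun n _ => x ^ n) ≤ F ^ T := by
  induction T with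
  | zero => simp [tally, upperExp]
  | succ T ih =>
    simp only [tally, upperExp_bind, upperExp, pow_add]
    have h1 : ∀ b : Bool, (tally d T).upperExp A (fun n _ => x ^ b.toNat * x ^ n)
        ≤ F ^ T * x ^ b.toNat := by
      intro b
      rw [upperExp_const_mul _ (pow_nonneg hx _), mul_comm]
      exact mul_le_mul_of_nonneg_right ih (pow_nonneg hx _)
    refine (upperExp_mono d fun b c => h1 b).trans ?_
    rw [upperExp_const_mul _ (pow_nonneg hF _), pow_one]
    exact mul_le_mul_of_nonneg_left hd (pow_nonneg hF _)

lemma failure_tally_cost {d : Strategy E Bool} {C : ℕ} (hd : d.failure A (fun _ c => c ≤ C) ≤ 0)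
    (T : ℕ) : (tally d T).failure A (fun _ c => c ≤ T * C) ≤ 0 := by
  induction T with
  | zero => exact failure_ret_le (by simp)
  | succ T ih =>
    refine (failure_bind_le hd le_rfl fun b c hc => ?_).trans_eq (add_zero 0)
    refine (failure_bind_le ih le_rfl fun n c' hc' => ?_).trans_eq (add_zero 0)
    exact failure_ret_le (by rw [add_mul]; omega)

lemma failure_under_cost {d : Strategy E Bool} {C : ℕ} (hd : d.failure A (fun _ c => c ≤ C) ≤ 0)
    (T s : ℕ) : (under d T s).failure A (fun _ c => c ≤ T * C) ≤ 0 :=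
  (failure_bind_le (failure_tally_cost hd T) le_rfl fun _ _ hc =>
    failure_ret_le (by omega)).trans_eq (add_zero 0)

/-- Chernoff bound for the event that there are too many successes. -/
lemma failure_under_eq_true_le {d : Strategy E Bool} {x y : ℝ} (hx : 1 ≤ x)
    (hd : d.failure A (fun b _ => b = false) ≤ y) (T s : ℕ) :
    (under d T s).failure A (fun b _ => b = true) ≤ (1 + (x - 1) * y) ^ T / x ^ s := by
  have hx0 : 0 < x := by linarith
  have hy : 0 ≤ y := (failure_nonneg _ _).trans hd
  have hxy : 0 ≤ (x - 1) * y := mul_nonneg (by linarith) hy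
  have h1 : d.upperExp A (fun b _ => x ^ b.toNat) ≤ 1 + (x - 1) * y := by
    calc _ ≤ d.upperExp A (fun b _ =>
          1 + (x - 1) * (if b = false then (0 : ℝ) else 1)) :=
          upperExp_mono d fun b c => by cases b <;> simp
      _ ≤ d.upperExp A (fun _ _ => 1) + d.upperExp A (fun b _ => (x - 1) *
          (if b = false then (0 : ℝ) else 1)) := upperExp_add_le d _ _
      _ ≤ _ := by
          rw [upperExp_const, upperExp_const_mul _ (by linarith)]
          have : (x - 1) * d.failure A (fun b _ => b = false) ≤ (x - 1) * y :=
            mul_le_mul_of_nonneg_left hd (by linarith)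
          rw [failure_eq_upperExp] at this
          exact add_le_add le_rfl this
  have h2 := upperExp_tally_le hx0.le h1 (by linarith) T
  simp only [under, failure, upperExp_bind, upperExp]
  rw [div_eq_inv_mul]
  refine le_trans ?_ (mul_le_mul_of_nonneg_left h2 (by positivity))
  rw [← upperExp_const_mul _ (by positivity)]
  refine upperExp_mono _ fun n c => ?_
  by_cases h : n < s
  · simp [h]; positivity
  · simp only [h, decide_false, Bool.false_eq_true, if_false]
    rw [inv_mul_eq_div, one_le_div (by positivity)]
    exact pow_le_pow_right₀ hx (by omega)

/-- Chernoff bound for the event that there are too few successes. -/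
lemma failure_under_eq_false_le {d : Strategy E Bool} {x y : ℝ} (hx : 0 < x) (hx1 : x ≤ 1)
    (hd : d.failure A (fun b _ => b = true) ≤ y) (T s : ℕ) :
    (under d T s).failure A (fun b _ => b = false) ≤ (x + (1 - x) * y) ^ T / x ^ s := by
  have hy : 0 ≤ y := (failure_nonneg _ _).trans hd
  have hxy : 0 ≤ (1 - x) * y := mul_nonneg (by linarith) hy
  have h1 : d.upperExp A (fun b _ => x ^ b.toNat) ≤ x + (1 - x) * y := by
    calc _ ≤ d.upperExp A (fun b _ =>
          x + (1 - x) * (if b = true then (0 : ℝ) else 1)) :=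
          upperExp_mono d fun b c => by cases b <;> simp
      _ ≤ d.upperExp A (fun _ _ => x) + d.upperExp A (fun b _ => (1 - x) *
          (if b = true then (0 : ℝ) else 1)) := upperExp_add_le d _ _
      _ ≤ _ := by
          rw [upperExp_const, upperExp_const_mul _ (by linarith)]
          have : (1 - x) * d.failure A (fun b _ => b = true) ≤ (1 - x) * y :=
            mul_le_mul_of_nonneg_left hd (by linarith)
          rw [failure_eq_upperExp] at this
          exact add_le_add le_rfl this
  have h2 := upperExp_tally_le hx.le h1 (by linarith) T
  simp only [under, failure, upperExp_bind, upperExp]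
  rw [div_eq_inv_mul]
  refine le_trans ?_ (mul_le_mul_of_nonneg_left h2 (by positivity))
  rw [← upperExp_const_mul _ (by positivity)]
  refine upperExp_mono _ fun n c => ?_
  by_cases h : n < s
  · simp only [h, decide_true, Bool.true_eq_false, if_false]
    rw [inv_mul_eq_div, one_le_div (by positivity)]
    exact pow_le_pow_of_le_one hx.le hx1 h.le
  · simp [h]; positivity

lemma failure_sift_le {p : β → Strategy E Bool} (must mustNot : β → Prop) {C : ℕ} {q : ℝ}
    (hq : 0 ≤ q) (l : List β)
    (h : ∀ b ∈ l, (p b).failure A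
      (fun k c => ((must b → k = true) ∧ (mustNot b → k = false)) ∧ c ≤ C) ≤ q) :
    (sift p l).failure A (fun l' c => (l'.Sublist l ∧ (∀ b ∈ l, must b → b ∈ l')
      ∧ ∀ b ∈ l', ¬ mustNot b) ∧ c ≤ l.length * C) ≤ l.length * q := by
  induction l with
  | nil => exact (failure_ret_le (by simp)).trans_eq (by simp)
  | cons b l ih =>
    have ih := ih fun b hb => h b (List.mem_cons_of_mem _ hb)
    have hlen : ((b :: l).length : ℝ) * q = q + l.length * q := by
      rw [List.length_cons]; push_cast; ring
    rw [hlen]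
    refine failure_bind_le (h b List.mem_cons_self) (by positivity) fun k c hk => ?_
    refine (failure_bind_le ih le_rfl fun l' c' hl' => ?_).trans_eq (add_zero _)
    apply failure_ret_le
    obtain ⟨⟨hk1, hk2⟩, hc⟩ := hk
    obtain ⟨⟨h1, h2, h3⟩, hc'⟩ := hl'
    refine ⟨?_, by rw [List.length_cons, add_mul]; omega⟩
    cases k with
    | true =>
      refine ⟨h1.cons_cons b, fun x hx hm => ?_, fun x hx hm => ?_⟩
      · rcases List.mem_cons.1 hx with rfl | hx
        · simp
        · simpa using Or.inr (h2 x hx hm)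
      · rcases List.mem_cons.1 (by simpa using hx) with rfl | hx
        · exact absurd (hk2 hm) (by simp)
        · exact h3 x hx hm
    | false =>
      refine ⟨h1.cons b, fun x hx hm => ?_, fun x hx hm => h3 x (by simpa using hx) hm⟩
      rcases List.mem_cons.1 hx with rfl | hx
      · exact absurd (hk1 hm) (by simp)
      · simpa using h2 x hx hm

end Strategy

/-! ### Elimination of columns by double counting. -/

lemma List.sum_map_countP_comm {α β : Type*} (R : List α) (S : List β) (p : α → β → Bool) :
    (R.map fun i => S.countP (p i)).sum = (S.map fun j => R.countP fun i => p i j).sum := by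
  have hS : ∀ (q : β → Bool), S.countP q = (S.map fun j => if q j then 1 else 0).sum := by
    intro q
    induction S with
    | nil => rfl
    | cons j S ih => simp only [List.countP_cons, List.map_cons, List.sum_cons, ih]; ring
  induction R with
  | nil => simp
  | cons i R ih =>
    simp only [List.map_cons, List.sum_cons, List.countP_cons, List.sum_map_add, ih, ← hS]
    ring

/-- If every row of a `0`-`1`-matrix has more than a quarter of ones, then at most `6/7` of its
columns have less than an eighth of ones. -/
lemma List.seven_mul_countP_sparse_le {α β : Type*} (R : List α) (S : List β) (p : α → β → Bool)
    (hR : R ≠ []) (h : ∀ i ∈ R, S.length ≤ 4 * S.countP (p i)) :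
    7 * S.countP (fun j => 8 * R.countP (fun i => p i j) < R.length) ≤ 6 * S.length := by
  have h1 : R.length * S.length ≤ 4 * (R.map fun i => S.countP (p i)).sum := by
    clear hR
    induction R with
    | nil => simp
    | cons i R ih =>
      have := ih fun i hi => h i (List.mem_cons_of_mem _ hi)
      have := h i List.mem_cons_self
      simp only [List.map_cons, List.sum_cons, List.length_cons]
      linarith
  -- The length of `R` is replaced by any bound `k` so that the induction runs over the columns
  -- alone. Eight times the count of a sparse column is short of `8 * k` by at least `7 * k`.
  have h2 : ∀ k : ℕ, (∀ j, R.countP (fun i => p i j) ≤ k) →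
      8 * (S.map fun j => R.countP fun i => p i j).sum
        + 7 * k * S.countP (fun j => 8 * R.countP (fun i => p i j) < k) ≤ 8 * k * S.length := by
    intro k hk
    clear h h1
    induction S with
    | nil => simp
    | cons j S ih =>
      simp only [List.map_cons, List.sum_cons, List.length_cons, List.countP_cons]
      have := hk j
      by_cases hj : 8 * R.countP (fun i => p i j) < k
      · simp only [hj, decide_true, if_true]
        linarith
      · simp only [hj, decide_false, Bool.false_eq_true, if_false]
        linarith
  have h3 := h2 R.length fun j => List.countP_le_length
  rw [← List.sum_map_countP_comm] at h3
  have hpos : 0 < R.length := List.length_pos_iff.2 hR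
  refine Nat.le_of_mul_le_mul_left ?_ hpos
  linarith

namespace Strategy

variable {E α β : Type} {A : E → ℝ}

/-- One round of elimination: keep those rows `R'` where `t₁ i` rarely succeeds on a random column,
and then those columns `j` where `t₂ · j` hardly ever succeeds on a random row from `R'`. -/
def eliminate (t₁ t₂ : α → β → Strategy E Bool) (t : ℕ) (R : List α) (S : List β) :
    Strategy E (List β) :=
  (sift (fun i => under (draw S (t₁ i)) (16 * t) (10 * t)) R).bind fun R' =>
    sift (fun j => under (draw R' fun i => t₂ i j) (16 * t) t) S

/-- `t₁` detects entries that are not `good`, and `t₂` detects entries that are `good`, where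
mistakes of `t₁` are rare on `far` entries, and mistakes of `t₂` on `low` entries. -/
structure IsTestPair (A : E → ℝ) (t₁ t₂ : α → β → Strategy E Bool) (far good low : α → β → Prop)
    (C : ℕ) : Prop where
  fst_far : ∀ i j, far i j → (t₁ i j).failure A (fun b _ => b = false) ≤ 1 / 100
  fst_good : ∀ i j, ¬ good i j → (t₁ i j).failure A (fun b _ => b = true) ≤ 1 / 100
  fst_cost : ∀ i j, (t₁ i j).failure A (fun _ c => c ≤ C) ≤ 0
  snd_low : ∀ i j, low i j → (t₂ i j).failure A (fun b _ => b = false) ≤ 1 / 100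
  snd_good : ∀ i j, good i j → (t₂ i j).failure A (fun b _ => b = true) ≤ 1 / 100
  snd_cost : ∀ i j, (t₂ i j).failure A (fun _ c => c ≤ C) ≤ 0

/-- If `p` or `q` is false, nothing is demanded in that direction; hence one `x` for each direction.
-/
lemma failure_dichotomy_le {P : Strategy E Bool} {p q : Prop} {C : ℕ} {x : ℝ} (hx : 0 ≤ x)
    (hp : p → P.failure A (fun b _ => b = true) ≤ x)
    (hq : q → P.failure A (fun b _ => b = false) ≤ x)
    (hC : P.failure A (fun _ c => c ≤ C) ≤ 0) :
    P.failure A (fun b c => ((p → b = true) ∧ (q → b = false)) ∧ c ≤ C) ≤ 2 * x := by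
  have key : ∀ (p : Prop) (b' : Bool), (p → P.failure A (fun b _ => b = b') ≤ x) →
      P.failure A (fun b _ => p → b = b') ≤ x := by
    intro p b' h
    by_cases hp : p
    · simpa [hp] using h hp
    · refine le_trans ?_ hx
      simp only [hp, false_imp_iff, failure_eq_upperExp, if_true, upperExp_const, le_refl]
  refine (failure_and_le P _ _).trans ?_
  have := failure_and_le (A := A) P (fun b _ => p → b = true) (fun b _ => q → b = false)
  linarith [key p true hp, key q false hq]

lemma pow_div_pow_le {F x y : ℝ} {a b : ℕ} (hF : 0 ≤ F) (hx : 0 < x) (h : F ^ a / x ^ b ≤ y)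
    (t : ℕ) : F ^ (a * t) / x ^ (b * t) ≤ y ^ t := by
  rw [pow_mul, pow_mul, ← div_pow]
  exact pow_le_pow_left₀ (by positivity) h t

open Classical in
-- The threshold 10/16 separates the success rates of `t₁ i` on a random column: at most 51/100 if
-- at least half of the columns are far, at least 74/100 if at most a quarter are good.
lemma failure_row_under_le {t₁ t₂ : α → β → Strategy E Bool} {far good low : α → β → Prop} {C : ℕ}
    (h : IsTestPair A t₁ t₂ far good low C) (t : ℕ) {S : List β} (hS : S ≠ []) (i : α) :
    (under (draw S (t₁ i)) (16 * t) (10 * t)).failure A (fun b c =>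
      ((2 * S.countP (fun j => ¬ far i j) ≤ S.length → b = true) ∧
        (4 * S.countP (fun j => good i j) ≤ S.length → b = false)) ∧ c ≤ 16 * t * C)
      ≤ 2 * (9 / 10) ^ t := by
  have hpos : (0 : ℝ) < S.length := by exact_mod_cast List.length_pos_iff.2 hS
  refine failure_dichotomy_le (by positivity) (fun hm => ?_) (fun hm => ?_)
    (failure_under_cost (failure_draw_cost fun j _ => h.fst_cost i j) _ _)
  · have h1 := failure_draw_le hS (fun j => ¬ far i j) (by norm_num)
      fun j _ hj => h.fst_far i j (not_not.1 hj)
    have h2 : ((S.countP fun j => ¬ far i j : ℕ) : ℝ) / S.length ≤ 1 / 2 := by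
      rw [div_le_div_iff₀ hpos two_pos]
      have : ((2 * S.countP (fun j => ¬ far i j) : ℕ) : ℝ) ≤ S.length := by exact_mod_cast hm
      push_cast at this; linarith
    -- The base 3/2 brings the Chernoff factor per 16 runs with threshold 10 below 9/10.
    have h3 := failure_under_eq_true_le (x := 3 / 2) (y := 51 / 100) (by norm_num)
      (h1.trans (by linarith)) (16 * t) (10 * t)
    exact h3.trans (pow_div_pow_le (by norm_num) (by norm_num) (by norm_num) t)
  · have h1 := failure_draw_le hS (fun j => good i j) (by norm_num) fun j _ => h.fst_good i j
    have h2 : ((S.countP fun j => good i j : ℕ) : ℝ) / S.length ≤ 1 / 4 := by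
      rw [div_le_div_iff₀ hpos (by norm_num)]
      have : ((4 * S.countP (fun j => good i j) : ℕ) : ℝ) ≤ S.length := by exact_mod_cast hm
      push_cast at this; linarith
    have h3 := failure_under_eq_false_le (x := 2 / 3) (y := 26 / 100) (by norm_num) (by norm_num)
      (h1.trans (by linarith)) (16 * t) (10 * t)
    exact h3.trans (pow_div_pow_le (by norm_num) (by norm_num) (by norm_num) t)

open Classical in
-- The threshold 1/16 separates the success rates of `t₂ · j` on a random row: at most 1/100 in a
-- column of low entries, at least 115/1000 if an eighth of the rows are good.
lemma failure_col_under_le {t₁ t₂ : α → β → Strategy E Bool} {far good low : α → β → Prop} {C : ℕ}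
    (h : IsTestPair A t₁ t₂ far good low C) (t : ℕ) (R : List α) (j : β) :
    (under (draw R fun i => t₂ i j) (16 * t) t).failure A (fun b c =>
      (((∀ i, low i j) → b = true) ∧
        (R ≠ [] ∧ R.length ≤ 8 * R.countP (fun i => good i j) → b = false)) ∧ c ≤ 16 * t * C)
      ≤ 2 * (9 / 10) ^ t := by
  refine failure_dichotomy_le (by positivity) (fun hm => ?_) (fun hm => ?_)
    (failure_under_cost (failure_draw_cost fun i _ => h.snd_cost i j) _ _)
  · have h1 : (draw R fun i => t₂ i j).failure A (fun b _ => b = false) ≤ 1 / 100 := by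
      -- If no row was kept, `draw` returns `false`, and such a column is safe.
      by_cases hR : R = []
      · subst hR
        exact (failure_ret_le (p := fun b _ => b = false) rfl).trans (by norm_num)
      · have h1 := failure_draw_le hR (fun _ => False) (by norm_num)
          fun i _ _ => h.snd_low i j (hm i)
        simpa using h1
    have h3 := failure_under_eq_true_le (x := 2) (by norm_num) h1 (16 * t) (1 * t)
    rw [one_mul] at h3
    refine h3.trans ?_
    have := pow_div_pow_le (F := 1 + (2 - 1) * (1 / 100)) (x := 2) (y := 9 / 10) (a := 16) (b := 1)
      (by norm_num) (by norm_num) (by norm_num) t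
    rwa [one_mul] at this
  · obtain ⟨hR, hm⟩ := hm
    have hpos : (0 : ℝ) < R.length := by exact_mod_cast List.length_pos_iff.2 hR
    have h1 := failure_draw_le hR (fun i => ¬ good i j) (by norm_num)
      fun i _ hi => h.snd_good i j (not_not.1 hi)
    have h2 : ((R.countP fun i => ¬ good i j : ℕ) : ℝ) / R.length ≤ 7 / 8 := by
      rw [div_le_div_iff₀ hpos (by norm_num)]
      have h4 := List.length_eq_countP_add_countP (l := R) (fun i => decide (good i j))
      have h5 : (R.length : ℝ) ≤ 8 * R.countP (fun i => decide (good i j)) := by exact_mod_cast hm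
      have h6 : (R.length : ℝ) = R.countP (fun i => decide (good i j))
          + R.countP (fun i => decide (¬ good i j)) := by
        rw [← Nat.cast_add]
        norm_cast
        rw [h4]
        simp
      linarith
    have h3 := failure_under_eq_false_le (x := 1 / 2) (y := 885 / 1000) (by norm_num)
      (by norm_num) (h1.trans (by linarith)) (16 * t) (1 * t)
    rw [one_mul] at h3
    refine h3.trans ?_
    have := pow_div_pow_le (F := 1 / 2 + (1 - 1 / 2) * (885 / 1000)) (x := 1 / 2) (y := 9 / 10)
      (a := 16) (b := 1) (by norm_num) (by norm_num) (by norm_num) t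
    rwa [one_mul] at this

open Classical in
-- If half of `S` is far, row `i₀` is kept, so `R'` is nonempty. Every kept row has more than a
-- quarter of good columns, whereas a surviving column has less than an eighth of good rows in `R'`,
-- and averaging gives the factor 6/7. Column `j₀` is low in every row, so its survival does not
-- depend on `R'`.
lemma failure_eliminate_le {t₁ t₂ : α → β → Strategy E Bool} {far good low : α → β → Prop} {C : ℕ}
    (h : IsTestPair A t₁ t₂ far good low C) (t : ℕ) {R : List α} {S : List β}
    {i₀ : α} {j₀ : β} (hi : i₀ ∈ R) (hj : j₀ ∈ S) (hlow : ∀ i, low i j₀) :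
    (eliminate t₁ t₂ t R S).failure A (fun S' c => (S'.Sublist S ∧ j₀ ∈ S' ∧
      (2 * S.countP (fun j => ¬ far i₀ j) ≤ S.length → 7 * S'.length ≤ 6 * S.length)) ∧
        c ≤ (R.length + S.length) * (16 * t * C))
      ≤ (R.length + S.length) * (2 * (9 / 10) ^ t) := by
  have hS : S ≠ [] := List.ne_nil_of_mem hj
  rw [add_mul (R.length : ℝ)]
  refine failure_bind_le (failure_sift_le _ _ (by positivity) R fun i _ =>
    failure_row_under_le h t hS i) (by positivity) fun R' c hR' => ?_
  obtain ⟨⟨-, hR1, hR2⟩, hc⟩ := hR'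
  refine le_trans (failure_mono _ ?_) (failure_sift_le _ _ (by positivity) S fun j _ =>
    failure_col_under_le h t R' j)
  rintro S' c' ⟨⟨hS1, hS2, hS3⟩, hc'⟩
  refine ⟨⟨hS1, hS2 j₀ hj hlow, fun hfar => ?_⟩, by rw [add_mul]; omega⟩
  have hR'ne : R' ≠ [] := List.ne_nil_of_mem (hR1 i₀ hi hfar)
  have h1 := List.seven_mul_countP_sparse_le R' S (fun i j => decide (good i j)) hR'ne
    fun i hi => (not_le.1 (hR2 i hi)).le
  have h2 : S'.length
      = S'.countP (fun j => 8 * R'.countP (fun i => decide (good i j)) < R'.length) := by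
    rw [eq_comm, List.countP_eq_length]
    intro j hj
    have := hS3 j hj
    simp only [not_and, not_le] at this
    simpa using this hR'ne
  have h3 := hS1.countP_le (p := fun j =>
    decide (8 * R'.countP (fun i => decide (good i j)) < R'.length))
  omega

/-- Several rounds of elimination. -/
def eliminateRounds (t₁ t₂ : α → β → Strategy E Bool) (t : ℕ) (R : List α) :
    ℕ → List β → Strategy E (List β)
  | 0, S => ret S
  | K + 1, S => (eliminate t₁ t₂ t R S).bind (eliminateRounds t₁ t₂ t R K)

open Classical in
-- Once fewer than half of the columns are far, the first alternative holds for good, as later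
-- rounds only delete. Until then each round gains a factor 6/7.
lemma failure_eliminateRounds_le {t₁ t₂ : α → β → Strategy E Bool} {far good low : α → β → Prop}
    {C : ℕ} (h : IsTestPair A t₁ t₂ far good low C) (t : ℕ) {R : List α}
    {i₀ : α} {j₀ : β} (hi : i₀ ∈ R) (hlow : ∀ i, low i j₀) (K : ℕ) {S : List β} (hj : j₀ ∈ S) :
    (eliminateRounds t₁ t₂ t R K S).failure A (fun S' c => (S'.Sublist S ∧ j₀ ∈ S' ∧
      (S'.length < 2 * S.countP (fun j => ¬ far i₀ j) ∨ 7 ^ K * S'.length ≤ 6 ^ K * S.length)) ∧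
        c ≤ K * ((R.length + S.length) * (16 * t * C)))
      ≤ K * ((R.length + S.length) * (2 * (9 / 10) ^ t)) := by
  induction K generalizing S with
  | zero => exact (failure_ret_le (by simp [hj])).trans_eq (by simp)
  | succ K ih =>
    have hK : ((K + 1 : ℕ) : ℝ) * ((R.length + S.length) * (2 * (9 / 10) ^ t))
        = (R.length + S.length) * (2 * (9 / 10) ^ t)
          + K * ((R.length + S.length) * (2 * (9 / 10) ^ t)) := by
      push_cast; ring
    rw [hK]
    refine failure_bind_le (failure_eliminate_le h t hi hj hlow) (by positivity)
      fun S₁ c hS₁ => ?_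
    obtain ⟨⟨h1, h2, h3⟩, hc⟩ := hS₁
    have hlen : S₁.length ≤ S.length := h1.length_le
    refine le_trans (failure_mono _ ?_) ((ih h2).trans ?_)
    · rintro S₂ c' ⟨⟨g1, g2, g3⟩, hc'⟩
      have hlen2 : S₂.length ≤ S₁.length := g1.length_le
      have hcount := h1.countP_le (p := fun j => decide (¬ far i₀ j))
      refine ⟨⟨g1.trans h1, g2, ?_⟩, ?_⟩
      · rcases g3 with g3 | g3
        · left; omega
        · by_cases hfar : 2 * S.countP (fun j => ¬ far i₀ j) ≤ S.length
          · right
            have := h3 hfar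
            calc 7 ^ (K + 1) * S₂.length = 7 * (7 ^ K * S₂.length) := by ring
              _ ≤ 7 * (6 ^ K * S₁.length) := by gcongr
              _ = 6 ^ K * (7 * S₁.length) := by ring
              _ ≤ 6 ^ K * (6 * S.length) := by gcongr
              _ = _ := by ring
          · left; omega
      · calc c + c' ≤ (R.length + S.length) * (16 * t * C)
              + K * ((R.length + S₁.length) * (16 * t * C)) := add_le_add hc hc'
          _ ≤ (R.length + S.length) * (16 * t * C)
              + K * ((R.length + S.length) * (16 * t * C)) := by gcongr
          _ = _ := by ring
    · gcongr

/-! ### Comparing the value with a threshold. -/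

/-- Compare the value of the matrix with a threshold, where `τ i j` compares the entry `(i, j)`
with it: each test removes a row or a column, and the result is `true` if there are no columns
left, and `false` if there are no rows left. -/
def compareValue (τ : α → β → Strategy E Bool) : List α → List β → Strategy E Bool
  | [], _ => ret false
  | _ :: _, [] => ret true
  | i :: R, j :: S => (τ i j).bind fun b =>
      if b then compareValue τ (i :: R) S else compareValue τ R (j :: S)
  termination_by R S => R.length + S.length

/-- The walk preserves "`i₀` remains or `pLow`" and "`j₀` remains or `pHigh`"; an empty list leaves
only the second option. Only tests that delete `i₀` or `j₀` have to be right, and every test deletes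
something. -/
lemma failure_compareValue_le {τ : α → β → Strategy E Bool} {i₀ : α} {j₀ : β} {pLow pHigh : Prop}
    {C : ℕ} {q : ℝ} (hq : 0 ≤ q)
    (h : ∀ i j, (τ i j).failure A (fun b c =>
      ((b = false → i = i₀ → pLow) ∧ (b = true → j = j₀ → pHigh)) ∧ c ≤ C) ≤ q)
    (R : List α) (S : List β) (hi : i₀ ∈ R ∨ pLow) (hj : j₀ ∈ S ∨ pHigh) :
    (compareValue τ R S).failure A (fun b c =>
      ((b = false → pLow) ∧ (b = true → pHigh)) ∧ c ≤ (R.length + S.length) * C)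
      ≤ (R.length + S.length) * q := by
  induction hk : R.length + S.length generalizing R S with
  | zero =>
    obtain rfl : R = [] := List.length_eq_zero_iff.1 (by omega)
    rw [compareValue]
    exact (failure_ret_le (by simpa using hi)).trans (by positivity)
  | succ k ih =>
    match R, S with
    | [], S =>
      rw [compareValue]
      exact (failure_ret_le (by simpa using hi)).trans (by positivity)
    | i :: R, [] =>
      rw [compareValue]
      exact (failure_ret_le (by simpa using hj)).trans (by positivity)
    | i :: R, j :: S =>
      rw [compareValue]
      have hk' : (((i :: R).length : ℝ) + (j :: S).length) * q = q + k * q := by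
        have : (((i :: R).length : ℝ) + (j :: S).length) = k + 1 := by exact_mod_cast hk
        rw [this]; ring
      rw [hk']
      refine failure_bind_le (h i j) (by positivity) fun b c hb => ?_
      obtain ⟨⟨hb1, hb2⟩, hc⟩ := hb
      cases b with
      | true =>
        have hlen : (i :: R).length + S.length = k := by
          simp only [List.length_cons] at hk ⊢; omega
        have hj' : j₀ ∈ S ∨ pHigh := by
          rcases hj with hj | hj
          · rcases List.mem_cons.1 hj with hj | hj
            · exact Or.inr (hb2 rfl hj.symm)
            · exact Or.inl hj
          · exact Or.inr hj
        have := ih (i :: R) S hi hj' hlen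
        rw [← Nat.cast_add, hlen] at this
        refine le_trans (failure_mono _ ?_) this
        rintro b c' ⟨hbc, hc'⟩
        exact ⟨hbc, by rw [add_mul]; omega⟩
      | false =>
        have hlen : R.length + (j :: S).length = k := by
          simp only [List.length_cons] at hk ⊢; omega
        have hi' : i₀ ∈ R ∨ pLow := by
          rcases hi with hi | hi
          · rcases List.mem_cons.1 hi with hi | hi
            · exact Or.inr (hb1 rfl hi.symm)
            · exact Or.inl hi
          · exact Or.inr hi
        have := ih R (j :: S) hi' hj hlen
        rw [← Nat.cast_add, hlen] at this
        refine le_trans (failure_mono _ ?_) this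
        rintro b c' ⟨hbc, hc'⟩
        exact ⟨hbc, by rw [add_mul]; omega⟩

end Strategy

/-! ### Decision trees on a probability space of samples and coins. -/

/-- Independent families of `σ`-algebras on two spaces are independent on the product space. -/
lemma ProbabilityTheory.iIndep.prod {Ω Ω' ι ι' : Type*} {mΩ : MeasurableSpace Ω}
    {mΩ' : MeasurableSpace Ω'} {μ : Measure Ω} {ν : Measure Ω'} [IsProbabilityMeasure μ]
    [IsProbabilityMeasure ν] {m : ι → MeasurableSpace Ω} {m' : ι' → MeasurableSpace Ω'}
    (hle : ∀ i, m i ≤ mΩ) (hle' : ∀ i, m' i ≤ mΩ') (h : iIndep m μ) (h' : iIndep m' ν) :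
    iIndep (Sum.elim (fun i => (m i).comap Prod.fst) fun i => (m' i).comap Prod.snd)
      (μ.prod ν) := by
  rw [iIndep_iff]
  intro s f hf
  have h1 : ∀ i, ∃ t : Set Ω, Sum.inl i ∈ s → MeasurableSet[m i] t ∧ Prod.fst ⁻¹' t = f (Sum.inl i) := by
    intro i
    by_cases hi : Sum.inl i ∈ s
    · obtain ⟨t, ht⟩ := hf _ hi
      exact ⟨t, fun _ => ht⟩
    · exact ⟨∅, fun h => absurd h hi⟩
  have h2 : ∀ i, ∃ t : Set Ω', Sum.inr i ∈ s →
      MeasurableSet[m' i] t ∧ Prod.snd ⁻¹' t = f (Sum.inr i) := by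
    intro i
    by_cases hi : Sum.inr i ∈ s
    · obtain ⟨t, ht⟩ := hf _ hi
      exact ⟨t, fun _ => ht⟩
    · exact ⟨∅, fun h => absurd h hi⟩
  choose g hg using h1
  choose g' hg' using h2
  have hset : ⋂ i ∈ s, f i = (⋂ i ∈ s.toLeft, g i) ×ˢ (⋂ i ∈ s.toRight, g' i) := by
    ext ⟨x, y⟩
    simp only [Set.mem_iInter, Set.mem_prod, Finset.mem_toLeft, Finset.mem_toRight, Sum.forall]
    refine and_congr (forall₂_congr fun i hi => ?_) (forall₂_congr fun i hi => ?_)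
    · rw [← (hg i hi).2]; rfl
    · rw [← (hg' i hi).2]; rfl
  rw [hset, Measure.prod_prod, Finset.prod_sum_eq_prod_toLeft_mul_prod_toRight,
    h.meas_biInter fun i hi => (hg i (Finset.mem_toLeft.1 hi)).1,
    h'.meas_biInter fun i hi => (hg' i (Finset.mem_toRight.1 hi)).1]
  congr 1
  · refine Finset.prod_congr rfl fun i hi => ?_
    obtain ⟨h1, h2⟩ := hg i (Finset.mem_toLeft.1 hi)
    rw [← h2, measurePreserving_fst.measure_preimage (hle i _ h1).nullMeasurableSet]
  · refine Finset.prod_congr rfl fun i hi => ?_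
    obtain ⟨h1, h2⟩ := hg' i (Finset.mem_toRight.1 hi)
    rw [← h2, measurePreserving_snd.measure_preimage (hle' i _ h1).nullMeasurableSet]

/-- A table of independent random choices: the entry `(c, n)` is an element of `Fin (n + 1)`. -/
abbrev CoinTable : Type := ∀ p : ℕ × ℕ, Fin (p.2 + 1)

/-- The law of a table of independent uniform random choices. -/
noncomputable def coinLaw : Measure CoinTable :=
  Measure.infinitePi fun p => (PMF.uniformOfFintype (Fin (p.2 + 1))).toMeasure

instance : IsProbabilityMeasure coinLaw := by unfold coinLaw; infer_instance

lemma coinLaw_real_eq (p : ℕ × ℕ) (i : Fin (p.2 + 1)) :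
    coinLaw.real {s | s p = i} = 1 / ((p.2 : ℝ) + 1) := by
  have h : coinLaw {s | s p = i} = (PMF.uniformOfFintype (Fin (p.2 + 1))).toMeasure {i} :=
    (measurePreserving_eval_infinitePi
      (fun p : ℕ × ℕ => (PMF.uniformOfFintype (Fin (p.2 + 1))).toMeasure) p).measure_preimage
      (measurableSet_singleton i).nullMeasurableSet
  rw [measureReal_def, h, PMF.toMeasure_apply_singleton _ _ (measurableSet_singleton i)]
  have := ENNReal.toReal_natCast (p.2 + 1)
  push_cast at this
  simp [this]

lemma iIndep_coinLaw :
    iIndep (fun p => (inferInstance : MeasurableSpace (Fin (p.2 + 1))).comap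
      fun s : CoinTable => s p) coinLaw :=
  (iIndepFun_infinitePi (X := fun (p : ℕ × ℕ) (i : Fin (p.2 + 1)) => i) fun _ => measurable_id).iIndep

namespace Strategy

variable {E α β : Type}

/-- The result of a strategy, if the coins are given by `s` from the row `c` on, and the samples of
the entry `e` are `x e (m e)`, `x e (m e + 1)`, ... -/
noncomputable def result [DecidableEq E] : Strategy E α → CoinTable → ℕ → (E → ℕ → ℝ) → (E → ℕ) → α
  | ret a, _, _, _, _ => a
  | test e N θ k, s, c, x, m =>
    result (k (decide (N * θ ≤ ∑ i ∈ Finset.range N, x e (m e + i)))) s c x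
      (Function.update m e (m e + N))
  | flip n k, s, c, x, m => result (k (s (c, n))) s (c + 1) x m

/-- The list of the samples that a strategy takes, in chronological order. -/
noncomputable def trace [DecidableEq E] : Strategy E α → CoinTable → ℕ → (E → ℕ → ℝ) → (E → ℕ) → List (E × ℝ)
  | ret _, _, _, _, _ => []
  | test e N θ k, s, c, x, m =>
    (List.range N).map (fun i => (e, x e (m e + i))) ++
      trace (k (decide (N * θ ≤ ∑ i ∈ Finset.range N, x e (m e + i)))) s c x
        (Function.update m e (m e + N))
  | flip n k, s, c, x, m => trace (k (s (c, n))) s (c + 1) x m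

/-- The samples and coins that are not used yet. -/
def unused (m : E → ℕ) (c : ℕ) : Set ((E × ℕ) ⊕ (ℕ × ℕ)) :=
  {i | Sum.elim (fun p : E × ℕ => m p.1 ≤ p.2) (fun p : ℕ × ℕ => c ≤ p.1) i}

lemma unused_update_subset [DecidableEq E] (m : E → ℕ) (c : ℕ) (e : E) (N : ℕ) :
    unused (Function.update m e (m e + N)) c ⊆ unused m c := by
  rintro (⟨e', k⟩ | ⟨c', n⟩) h
  · simp only [unused, Set.mem_ofPred_eq, Sum.elim_inl] at h ⊢
    by_cases he : e' = e
    · subst he; simp at h; omega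
    · simpa [he] using h
  · exact h

lemma unused_succ_subset (m : E → ℕ) (c : ℕ) : unused m (c + 1) ⊆ unused m c := by
  rintro (⟨e', k⟩ | ⟨c', n⟩) h
  · exact h
  · simp only [unused, Set.mem_ofPred_eq, Sum.elim_inr] at h ⊢
    omega

/-- Random samples `Y` and coins `S` that satisfy the tail bounds for samples of the matrix with
the entries `A`. -/
structure IsSource {Ω : Type*} {mΩ : MeasurableSpace Ω} (A : E → ℝ) (μ : Measure Ω)
    (σ : (E × ℕ) ⊕ (ℕ × ℕ) → MeasurableSpace Ω) (Y : E → ℕ → Ω → ℝ) (S : Ω → CoinTable) :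
    Prop where
  le : ∀ i, σ i ≤ mΩ
  indep : iIndep σ μ
  measurable_sample : ∀ e k, Measurable[σ (Sum.inl (e, k))] (Y e k)
  measurable_coin : ∀ p, Measurable[σ (Sum.inr p)] fun ω => S ω p
  le_tailUpper : ∀ e k N θ, μ.real {ω | N * θ ≤ ∑ i ∈ Finset.range N, Y e (k + i) ω}
    ≤ tailUpper (A e) N θ
  tailLower_le : ∀ e k N θ,
    tailLower (A e) N θ ≤ μ.real {ω | N * θ ≤ ∑ i ∈ Finset.range N, Y e (k + i) ω}
  coin : ∀ p i, μ.real {ω | S ω p = i} = 1 / ((p.2 : ℝ) + 1)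

namespace IsSource

variable {Ω : Type*} {mΩ : MeasurableSpace Ω} {A : E → ℝ} {μ : Measure Ω}
  {σ : (E × ℕ) ⊕ (ℕ × ℕ) → MeasurableSpace Ω} {Y : E → ℕ → Ω → ℝ} {S : Ω → CoinTable}

/-- The samples used by a test. -/
def block (e : E) (k N : ℕ) : Set ((E × ℕ) ⊕ (ℕ × ℕ)) :=
  {i | ∃ l < N, i = Sum.inl (e, k + l)}

lemma measurableSet_block (h : IsSource A μ σ Y S) (e : E) (k N : ℕ) (θ : ℝ) :
    MeasurableSet[⨆ i ∈ block e k N, σ i]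
      {ω | N * θ ≤ ∑ i ∈ Finset.range N, Y e (k + i) ω} := by
  refine measurableSet_le (mδ := ⨆ i ∈ block e k N, σ i) measurable_const ?_
  refine Finset.measurable_sum _ fun l hl => ?_
  refine (h.measurable_sample e (k + l)).mono ?_ le_rfl
  exact le_iSup₂ (f := fun i (_ : i ∈ block e k N) => σ i) (Sum.inl (e, k + l))
    ⟨l, Finset.mem_range.1 hl, rfl⟩

lemma measurableSet_coin (h : IsSource A μ σ Y S) (p : ℕ × ℕ) (i : Fin (p.2 + 1)) :
    MeasurableSet[⨆ j ∈ ({Sum.inr p} : Set ((E × ℕ) ⊕ (ℕ × ℕ))), σ j] {ω | S ω p = i} := by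
  have := h.measurable_coin p (measurableSet_singleton i)
  rw [iSup_singleton]
  exact this

lemma block_subset_unused (m : E → ℕ) (c : ℕ) (e : E) (N : ℕ) :
    block e (m e) N ⊆ unused m c := by
  rintro _ ⟨l, -, rfl⟩
  simp [unused]

lemma disjoint_block_unused [DecidableEq E] (m : E → ℕ) (c : ℕ) (e : E) (N : ℕ) :
    Disjoint (block e (m e) N) (unused (Function.update m e (m e + N)) c) := by
  rw [Set.disjoint_left]
  rintro _ ⟨l, hl, rfl⟩ h
  simp [unused] at h
  omega

/-- The block of the test selects the branch, and the rest of the event concerns samples that are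
still unused. -/
lemma setOf_test_eq [DecidableEq E] (e : E) (N : ℕ) (θ : ℝ) (k : Bool → Strategy E α) (p : α → ℕ → Prop)
    (c : ℕ) (m : E → ℕ) :
    {ω | ¬ p ((test e N θ k).result (S ω) c (fun e k => Y e k ω) m)
      ((test e N θ k).trace (S ω) c (fun e k => Y e k ω) m).length} =
    ({ω | N * θ ≤ ∑ i ∈ Finset.range N, Y e (m e + i) ω} ∩
      {ω | ¬ p ((k true).result (S ω) c (fun e k => Y e k ω) (Function.update m e (m e + N)))
        (N + ((k true).trace (S ω) c (fun e k => Y e k ω)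
          (Function.update m e (m e + N))).length)}) ∪
    ({ω | N * θ ≤ ∑ i ∈ Finset.range N, Y e (m e + i) ω}ᶜ ∩
      {ω | ¬ p ((k false).result (S ω) c (fun e k => Y e k ω) (Function.update m e (m e + N)))
        (N + ((k false).trace (S ω) c (fun e k => Y e k ω)
          (Function.update m e (m e + N))).length)}) := by
  ext ω
  by_cases hω : N * θ ≤ ∑ i ∈ Finset.range N, Y e (m e + i) ω
  · simp [result, trace, hω]
  · simp [result, trace, hω]

lemma setOf_flip_eq [DecidableEq E] (n : ℕ) (k : Fin (n + 1) → Strategy E α) (p : α → ℕ → Prop)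
    (c : ℕ) (m : E → ℕ) :
    {ω | ¬ p ((flip n k).result (S ω) c (fun e k => Y e k ω) m)
      ((flip n k).trace (S ω) c (fun e k => Y e k ω) m).length} =
    ⋃ i ∈ (Finset.univ : Finset (Fin (n + 1))), {ω | S ω (c, n) = i} ∩
      {ω | ¬ p ((k i).result (S ω) (c + 1) (fun e k => Y e k ω) m)
        ((k i).trace (S ω) (c + 1) (fun e k => Y e k ω) m).length} := by
  ext ω
  simp [result, trace]

/-- Measurability with respect to the unused samples and coins alone is what makes the event
independent of the blocks consumed before. -/
lemma measurableSet_not [DecidableEq E] (h : IsSource A μ σ Y S) (P : Strategy E α) (p : α → ℕ → Prop)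
    (c : ℕ) (m : E → ℕ) :
    MeasurableSet[⨆ i ∈ unused m c, σ i]
      {ω | ¬ p (P.result (S ω) c (fun e k => Y e k ω) m)
        (P.trace (S ω) c (fun e k => Y e k ω) m).length} := by
  induction P generalizing p c m with
  | ret a => exact MeasurableSet.const (m := ⨆ i ∈ unused m c, σ i) (¬ p a 0)
  | test e N θ k ih =>
    have hb := biSup_mono (f := σ) (block_subset_unused m c e N) _ (h.measurableSet_block e (m e) N θ)
    have hu := fun b => biSup_mono (f := σ) (unused_update_subset m c e N) _
      (ih b (fun a l => p a (N + l)) c (Function.update m e (m e + N)))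
    rw [setOf_test_eq]
    exact (hb.inter (hu true)).union (hb.compl.inter (hu false))
  | flip n k ih =>
    rw [setOf_flip_eq]
    refine Finset.measurableSet_biUnion _ fun i _ => MeasurableSet.inter ?_
      (biSup_mono (f := σ) (unused_succ_subset m c) _ (ih i p (c + 1) m))
    refine biSup_mono (f := σ) ?_ _ (h.measurableSet_coin (c, n) i)
    simp [unused]

lemma measureReal_inter_eq (h : IsSource A μ σ Y S) {I J : Set ((E × ℕ) ⊕ (ℕ × ℕ))}
    (hIJ : Disjoint I J) {s t : Set Ω} (hs : MeasurableSet[⨆ i ∈ I, σ i] s)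
    (ht : MeasurableSet[⨆ i ∈ J, σ i] t) : μ.real (s ∩ t) = μ.real s * μ.real t := by
  have := (Indep_iff _ _ _).1 (indep_iSup_of_disjoint h.le h.indep hIJ) s t hs ht
  simp [measureReal_def, this]

/-- An affine function of `q` on an interval is largest at an endpoint; this justifies the two-term
maximum in `upperExp`. -/
lemma convexComb_le_max {l q u x y : ℝ} (h1 : l ≤ q) (h2 : q ≤ u) :
    q * x + (1 - q) * y ≤ max (u * x + (1 - u) * y) (l * x + (1 - l) * y) := by
  rcases le_total y x with h | h
  · exact le_max_of_le_left (by nlinarith)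
  · exact le_max_of_le_right (by nlinarith)

/-- The failure bound of a strategy holds for random samples. -/
theorem measureReal_not_le_failure [DecidableEq E] [IsProbabilityMeasure μ] (h : IsSource A μ σ Y S)
    (P : Strategy E α) (p : α → ℕ → Prop) (c : ℕ) (m : E → ℕ) :
    μ.real {ω | ¬ p (P.result (S ω) c (fun e k => Y e k ω) m)
        (P.trace (S ω) c (fun e k => Y e k ω) m).length} ≤ P.failure A p := by
  have hle : ∀ I : Set ((E × ℕ) ⊕ (ℕ × ℕ)), ⨆ i ∈ I, σ i ≤ mΩ := fun I => iSup₂_le fun i _ => h.le i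
  induction P generalizing p c m with
  | ret a =>
    by_cases hp : p a 0 <;> simp [result, trace, failure, upperExp, hp]
  | test e N θ k ih =>
    have ih := fun b => ih b (fun a l => p a (N + l)) c (Function.update m e (m e + N))
    have hb := h.measurableSet_block e (m e) N θ
    have hu := fun b => h.measurableSet_not (k b) (fun a l => p a (N + l)) c
      (Function.update m e (m e + N))
    have hd := disjoint_block_unused m c e N
    rw [setOf_test_eq]
    refine (measureReal_union_le _ _).trans ?_
    rw [h.measureReal_inter_eq hd hb (hu true), h.measureReal_inter_eq hd hb.compl (hu false),
      probReal_compl_eq_one_sub (hle _ _ hb)]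
    refine (convexComb_le_max (h.tailLower_le e (m e) N θ) (h.le_tailUpper e (m e) N θ)).trans ?_
    exact max_le_max
      (convexComb_mono (tailUpper_nonneg _ _ _) (tailUpper_le_one _ _ _) (ih true) (ih false))
      (convexComb_mono (tailLower_nonneg _ _ _) (tailLower_le_one _ _ _) (ih true) (ih false))
  | flip n k ih =>
    rw [setOf_flip_eq]
    refine (measureReal_biUnion_finset_le _ _).trans ?_
    simp only [failure, upperExp]
    rw [Finset.sum_div]
    refine Finset.sum_le_sum fun i _ => ?_
    have hd : Disjoint ({Sum.inr (c, n)} : Set ((E × ℕ) ⊕ (ℕ × ℕ))) (unused m (c + 1)) := by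
      simp [unused]
    rw [h.measureReal_inter_eq hd (h.measurableSet_coin (c, n) i)
      (h.measurableSet_not (k i) p (c + 1) m), h.coin, div_mul_eq_mul_div, one_mul]
    have := ih i p (c + 1) m
    gcongr
    exact this

end IsSource

end Strategy

/-! ### Tail bounds for noisy samples. -/

namespace IsNoisySampling

variable {n m : ℕ} {A : Matrix (Fin n) (Fin m) ℝ} {Ω : Type*} [MeasurableSpace Ω]
  {μ : Measure Ω} {X : Fin n × Fin m → ℕ → Ω → ℝ}

/-- The sign `s` covers both tails at once. -/
lemma measureReal_noise_le (h : IsNoisySampling A μ X) (e : Fin n × Fin m) (k N : ℕ) {ε s : ℝ}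
    (hε : 0 ≤ ε) (hs : s = 1 ∨ s = -1) :
    μ.real {ω | N * ε ≤ ∑ i ∈ Finset.range N, s * (X e (k + i) ω - A e.1 e.2)}
      ≤ Real.exp (-(N * ε ^ 2 / 2)) := by
  have hinj : Function.Injective fun i : ℕ => (e, k + i) := fun i j hij => by
    simpa using hij
  have h1 := (h.indep.precomp hinj).comp (fun _ x => s * (x - A e.1 e.2)) (fun _ => by fun_prop)
  have h2 : ∀ i < N, HasSubgaussianMGF (fun ω => s * (X e (k + i) ω - A e.1 e.2)) 1 μ := by
    intro i _
    have := h.subGaussian e (k + i)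
    rcases hs with rfl | rfl
    · simpa using this
    · simpa [Pi.neg_def] using this.neg
  refine (HasSubgaussianMGF.measure_sum_range_ge_le_of_iIndepFun h1 h2 (by positivity)).trans_eq ?_
  congr 1
  rcases Nat.eq_zero_or_pos N with rfl | hN
  · simp
  · have : (0 : ℝ) < N := by exact_mod_cast hN
    simp only [NNReal.coe_one]
    field_simp

lemma le_tailUpper [IsProbabilityMeasure μ] (h : IsNoisySampling A μ X) (e : Fin n × Fin m)
    (k N : ℕ) (θ : ℝ) :
    μ.real {ω | N * θ ≤ ∑ i ∈ Finset.range N, X e (k + i) ω} ≤ tailUpper (A e.1 e.2) N θ := by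
  unfold tailUpper
  split_ifs with hθ
  · refine le_trans (measureReal_mono fun ω hω => ?_)
      (h.measureReal_noise_le e k N (ε := θ - A e.1 e.2) (by linarith) (Or.inl rfl))
    simp only [Set.mem_ofPred_eq, one_mul, Finset.sum_sub_distrib, Finset.sum_const,
      Finset.card_range, nsmul_eq_mul] at hω ⊢
    linarith
  · exact measureReal_le_one

lemma tailLower_le [IsProbabilityMeasure μ] (h : IsNoisySampling A μ X) (e : Fin n × Fin m)
    (k N : ℕ) (θ : ℝ) :
    tailLower (A e.1 e.2) N θ ≤ μ.real {ω | N * θ ≤ ∑ i ∈ Finset.range N, X e (k + i) ω} := by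
  unfold tailLower
  split_ifs with hθ
  · have hm : MeasurableSet {ω | N * θ ≤ ∑ i ∈ Finset.range N, X e (k + i) ω} :=
      measurableSet_le measurable_const (Finset.measurable_sum _ fun i _ => h.measurable e _)
    have h1 := probReal_compl_eq_one_sub (μ := μ) hm
    have h2 : μ.real {ω | N * θ ≤ ∑ i ∈ Finset.range N, X e (k + i) ω}ᶜ
        ≤ Real.exp (-(N * (A e.1 e.2 - θ) ^ 2 / 2)) := by
      refine le_trans (measureReal_mono fun ω hω => ?_)
        (h.measureReal_noise_le e k N (ε := A e.1 e.2 - θ) (by linarith) (Or.inr rfl))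
      simp only [Set.mem_compl_iff, Set.mem_ofPred_eq, not_le, ← Finset.mul_sum,
        Finset.sum_sub_distrib, Finset.sum_const, Finset.card_range, nsmul_eq_mul] at hω ⊢
      linarith
    linarith
  · exact measureReal_nonneg

/-- The `σ`-algebras of the single samples and coins. -/
abbrev sigma (X : Fin n × Fin m → ℕ → Ω → ℝ) :
    ((Fin n × Fin m) × ℕ) ⊕ (ℕ × ℕ) → MeasurableSpace (Ω × CoinTable) :=
  Sum.elim (fun p => (MeasurableSpace.comap (X p.1 p.2) inferInstance).comap Prod.fst)
    fun p => (MeasurableSpace.comap (fun s : CoinTable => s p) inferInstance).comap Prod.snd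

lemma isSource [IsProbabilityMeasure μ] (h : IsNoisySampling A μ X) :
    Strategy.IsSource (fun e => A e.1 e.2) (μ.prod coinLaw) (sigma X)
      (fun e k ω => X e k ω.1) (fun ω => ω.2) where
  le := by
    rintro (p | p)
    · exact MeasurableSpace.comap_le_iff_le_map.2
        ((h.measurable p.1 p.2).comap_le.trans measurable_fst.le_map)
    · exact MeasurableSpace.comap_le_iff_le_map.2
        ((measurable_pi_apply p).comap_le.trans measurable_snd.le_map)
  indep := ProbabilityTheory.iIndep.prod (fun p => (h.measurable p.1 p.2).comap_le)
    (fun p => (measurable_pi_apply p).comap_le) h.indep.iIndep iIndep_coinLaw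
  measurable_sample := fun e k t ht => ⟨_, ⟨t, ht, rfl⟩, rfl⟩
  measurable_coin := fun p t ht => ⟨_, ⟨t, ht, rfl⟩, rfl⟩
  le_tailUpper := fun e k N θ => by
    have hm : MeasurableSet {ω | N * θ ≤ ∑ i ∈ Finset.range N, X e (k + i) ω} :=
      measurableSet_le measurable_const (Finset.measurable_sum _ fun i _ => h.measurable e _)
    have := (measurePreserving_fst (μ := μ) (ν := coinLaw)).measureReal_preimage hm.nullMeasurableSet
    exact this.le.trans (h.le_tailUpper e k N θ)
  tailLower_le := fun e k N θ => by
    have hm : MeasurableSet {ω | N * θ ≤ ∑ i ∈ Finset.range N, X e (k + i) ω} :=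
      measurableSet_le measurable_const (Finset.measurable_sum _ fun i _ => h.measurable e _)
    have := (measurePreserving_fst (μ := μ) (ν := coinLaw)).measureReal_preimage hm.nullMeasurableSet
    exact (h.tailLower_le e k N θ).trans this.ge
  coin := fun p i => by
    have hm : MeasurableSet {s : CoinTable | s p = i} :=
      (measurable_pi_apply p : Measurable fun s : CoinTable => s p) (measurableSet_singleton i)
    have := (measurePreserving_snd (μ := μ) (ν := coinLaw)).measureReal_preimage hm.nullMeasurableSet
    exact this.trans (coinLaw_real_eq p i)

end IsNoisySampling

/-! ### From decision trees to a learner that sees only its history. -/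

namespace Strategy

variable {E α β : Type}

/-- The next step of a strategy when `t` samples are known: either the entry to be sampled next, or
the result.  The samples `v 0, …, v (t - 1)` before the position `pos` and the coins before the
row `c` have been used already; the new values of `c` and `pos` are returned with the result. -/
noncomputable def replay :
    Strategy E α → CoinTable → ℕ → (ℕ → ℝ) → ℕ → ℕ → E ⊕ (α × ℕ × ℕ)
  | ret a, _, c, _, pos, _ => Sum.inr (a, c, pos)
  | test e N θ k, s, c, v, pos, t =>
    if t < pos + N then Sum.inl e
    else replay (k (decide (N * θ ≤ ∑ i ∈ Finset.range N, v (pos + i)))) s c v (pos + N) t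
  | flip n k, s, c, v, pos, t => replay (k (s (c, n))) s (c + 1) v pos t

lemma replay_bind (P : Strategy E α) (g : α → Strategy E β) (s : CoinTable) (c : ℕ) (v : ℕ → ℝ)
    (pos t : ℕ) : (P.bind g).replay s c v pos t =
      (P.replay s c v pos t).elim Sum.inl fun r => (g r.1).replay s r.2.1 v r.2.2 t := by
  induction P generalizing c pos with
  | ret a => rfl
  | test e N θ k ih =>
    simp only [bind, replay]
    split_ifs
    · rfl
    · exact ih _ _ _
  | flip n k ih => exact ih _ _ _

lemma pos_le_of_replay_eq (P : Strategy E α) (s : CoinTable) (c : ℕ) (v : ℕ → ℝ) {pos t : ℕ}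
    {r : α × ℕ × ℕ} (hpos : pos ≤ t) (h : P.replay s c v pos t = Sum.inr r) :
    pos ≤ r.2.2 ∧ r.2.2 ≤ t := by
  induction P generalizing c pos with
  | ret a =>
    simp only [replay, Sum.inr.injEq] at h
    subst h
    exact ⟨le_rfl, hpos⟩
  | test e N θ k ih =>
    simp only [replay] at h
    split_ifs at h with ht
    have := ih _ _ (by omega) h
    omega
  | flip n k ih => exact ih _ _ hpos h

/-- A finite tree has finitely many outcomes, each on a measurable set, so an arbitrary `φ` is
allowed and `α` needs no `σ`-algebra. -/
lemma measurable_replay {Γ Z : Type*} [MeasurableSpace Γ] [MeasurableSpace Z] (P : Strategy E α)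
    (φ : E ⊕ (α × ℕ × ℕ) → Z) {s : Γ → CoinTable} {v : ℕ → Γ → ℝ} (hs : Measurable s)
    (hv : ∀ k, Measurable (v k)) (c pos t : ℕ) :
    Measurable fun γ => φ (P.replay (s γ) c (fun k => v k γ) pos t) := by
  induction P generalizing c pos with
  | ret a =>
    simp only [replay]
    exact measurable_const
  | test e N θ k ih =>
    classical
    simp only [replay]
    split_ifs with h
    · exact measurable_const
    · have hm : MeasurableSet {γ | N * θ ≤ ∑ i ∈ Finset.range N, v (pos + i) γ} :=
        measurableSet_le measurable_const (Finset.measurable_sum _ fun i _ => hv _)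
      have hite : Measurable fun γ => if N * θ ≤ ∑ i ∈ Finset.range N, v (pos + i) γ
          then φ ((k true).replay (s γ) c (fun k => v k γ) (pos + N) t)
          else φ ((k false).replay (s γ) c (fun k => v k γ) (pos + N) t) :=
        Measurable.ite hm (ih true c (pos + N)) (ih false c (pos + N))
      convert hite using 2 with γ
      split_ifs with hγ <;> simp [hγ]
  | flip n k ih =>
    simp only [replay]
    have h1 : Measurable fun q : Fin (n + 1) × Γ =>
        φ ((k q.1).replay (s q.2) (c + 1) (fun k => v k q.2) pos t) :=
      measurable_from_prod_countable_right fun i => ih i (c + 1) pos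
    exact h1.comp (((measurable_pi_apply (c, n)).comp hs).prodMk measurable_id)

variable [DecidableEq E]

/-- A test is evaluated only when its whole block is known, so the first `d` values determine which
entry comes next. -/
lemma replay_eq_inl (P : Strategy E α) (s : CoinTable) (c : ℕ) (x : E → ℕ → ℝ) (m : E → ℕ)
    (v : ℕ → ℝ) (pos d : ℕ) (hd : d < (P.trace s c x m).length)
    (hv : ∀ k (hk : k < (P.trace s c x m).length), k < d → v (pos + k) = (P.trace s c x m)[k].2) :
    P.replay s c v pos (pos + d) = Sum.inl (P.trace s c x m)[d].1 := by
  induction P generalizing c m pos d with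
  | ret a => simp [trace] at hd
  | test e N θ k ih =>
    simp only [replay, trace] at hd hv ⊢
    by_cases hdN : d < N
    · rw [if_pos (by omega), List.getElem_append_left (by simpa using hdN)]
      simp
    · rw [if_neg (by omega)]
      have hsum : ∑ i ∈ Finset.range N, v (pos + i) = ∑ i ∈ Finset.range N, x e (m e + i) := by
        refine Finset.sum_congr rfl fun i hi => ?_
        have hi := Finset.mem_range.1 hi
        rw [hv i (by simp; omega) (by omega), List.getElem_append_left (by simpa using hi)]
        simp
      rw [hsum]
      have hpos : pos + d = pos + N + (d - N) := by omega
      rw [hpos, ih _ c (Function.update m e (m e + N)) (pos + N) (d - N)]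
      · rw [List.getElem_append_right (by simp; omega)]
        simp
      · simp at hd; omega
      · intro l hl hld
        have := hv (N + l) (by simp; omega) (by omega)
        rw [← add_assoc] at this
        rw [this, List.getElem_append_right (by simp)]
        simp
  | flip n k ih => exact ih _ _ _ _ _ hd hv

lemma replay_eq_inr (P : Strategy E α) (s : CoinTable) (c : ℕ) (x : E → ℕ → ℝ) (m : E → ℕ)
    (v : ℕ → ℝ) (pos t : ℕ) (ht : t = pos + (P.trace s c x m).length)
    (hv : ∀ k (hk : k < (P.trace s c x m).length), v (pos + k) = (P.trace s c x m)[k].2) :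
    ∃ r, P.replay s c v pos t = Sum.inr (P.result s c x m, r) := by
  induction P generalizing c m pos with
  | ret a => exact ⟨_, rfl⟩
  | test e N θ k ih =>
    simp only [replay, trace, result] at hv ht ⊢
    rw [List.length_append, List.length_map, List.length_range] at ht
    rw [if_neg (by omega)]
    have hsum : ∑ i ∈ Finset.range N, v (pos + i) = ∑ i ∈ Finset.range N, x e (m e + i) := by
      refine Finset.sum_congr rfl fun i hi => ?_
      have hi := Finset.mem_range.1 hi
      rw [hv i (by simp; omega), List.getElem_append_left (by simpa using hi)]
      simp
    rw [hsum]
    refine ih _ c (Function.update m e (m e + N)) (pos + N) (by omega) fun l hl => ?_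
    have := hv (N + l) (by simp; omega)
    rw [← add_assoc] at this
    rw [this, List.getElem_append_right (by simp)]
    simp
  | flip n k ih => exact ih _ _ _ _ ht hv

/-- Matches the sample counters of a strategy with the occurrence counts by which `Learner.history`
indexes samples. -/
lemma getElem_trace_snd (P : Strategy E α) (s : CoinTable) (c : ℕ) (x : E → ℕ → ℝ) (m : E → ℕ)
    (d : ℕ) (hd : d < (P.trace s c x m).length) :
    (P.trace s c x m)[d].2 = x (P.trace s c x m)[d].1
      (m (P.trace s c x m)[d].1
        + (((P.trace s c x m).take d).map Prod.fst).count (P.trace s c x m)[d].1) := by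
  induction P generalizing c m d with
  | ret a => simp [trace] at hd
  | test e N θ k ih =>
    have key : ∀ tr : List (E × ℝ), (∀ d (hd : d < tr.length), tr[d].2 = x tr[d].1
        (Function.update m e (m e + N) tr[d].1 + ((tr.take d).map Prod.fst).count tr[d].1)) →
        ∀ l : List (E × ℝ), l = (List.range N).map (fun i => (e, x e (m e + i))) ++ tr →
        ∀ d (hd : d < l.length),
          l[d].2 = x l[d].1 (m l[d].1 + ((l.take d).map Prod.fst).count l[d].1) := by
      rintro tr htr l rfl d hd
      by_cases hdN : d < N
      · have h1 : d < ((List.range N).map fun i => (e, x e (m e + i))).length := by simpa using hdN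
        rw [List.getElem_append_left h1, List.take_append_of_le_length h1.le]
        simp only [List.getElem_map, List.getElem_range, ← List.map_take, List.map_map,
          Function.comp_def, List.map_const', List.length_take, List.length_range]
        simp [hdN.le]
      · have h1 : ((List.range N).map fun i => (e, x e (m e + i))).length ≤ d := by
          simp; omega
        have hd' : d - N < tr.length := by simp at hd; omega
        rw [List.getElem_append_right h1, List.take_append, List.take_of_length_le h1]
        simp only [List.length_map, List.length_range, List.map_append, List.count_append]
        rw [htr (d - N) hd']
        congr 1
        simp only [List.map_map, Function.comp_def, List.map_const', List.length_range,
          List.count_replicate]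
        generalize tr[d - N].1 = e'
        by_cases he : e' = e
        · subst he; simp; ring
        · simp [he, Ne.symm he]
    exact key _ (fun d hd => ih _ c _ d hd) _ rfl d hd
  | flip n k ih => exact ih _ _ _ _ hd

end Strategy

namespace Learner

open Strategy

variable {n m : ℕ} [NeZero n] [NeZero m]

/-- The learner that follows the strategies `Q F`, where `F` bounds the number of phases, and the
result `none` means that there are phases left. -/
noncomputable def ofStrategies (Q : ℕ → Strategy (Fin n × Fin m) (Option (Fin n × Fin m))) :
    Learner n m where
  Seed := CoinTable
  law := coinLaw
  act s h := ((Q (h.length + 1)).replay s 0 (fun k => (h.reverse.map Prod.snd).getD k 0) 0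
    h.length).map id fun r => r.1.getD (0, 0)
  measurable_act t := by
    simp only [List.length_ofFn]
    refine measurable_replay (Γ := CoinTable × (Fin t → (Fin n × Fin m) × ℝ)) (Q (t + 1)) (Sum.map id fun r => r.1.getD (0, 0)) measurable_fst
      (v := fun k p => ((List.ofFn p.2).reverse.map Prod.snd).getD k 0) (fun k => ?_) 0 0 t
    by_cases hk : k < t
    · have : (fun p : CoinTable × (Fin t → (Fin n × Fin m) × ℝ) =>
          ((List.ofFn p.2).reverse.map Prod.snd).getD k 0)
          = fun p => (p.2 ⟨t - 1 - k, by omega⟩).2 := by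
        funext p
        rw [List.getD_eq_getElem _ _ (by simpa using hk)]
        simp
      rw [this]
      fun_prop
    · have : (fun p : CoinTable × (Fin t → (Fin n × Fin m) × ℝ) =>
          ((List.ofFn p.2).reverse.map Prod.snd).getD k 0) = fun _ => 0 := by
        funext p
        rw [List.getD_eq_default _ _ (by simp; omega)]
      rw [this]
      exact measurable_const

/-- The strategies `Q F` agree until the phases are used up, and every phase takes a sample. -/
structure IsPhased {E : Type} (Q : ℕ → Strategy E (Option E)) : Prop where
  agree : ∀ F F' s v t, F ≤ F' → (∃ r, (Q F).replay s 0 v 0 t = Sum.inr (none, r)) ∨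
    (Q F).replay s 0 v 0 t = (Q F').replay s 0 v 0 t
  le_of_none : ∀ F s v t r, (Q F).replay s 0 v 0 t = Sum.inr (none, r) → F ≤ t

/-- With `t` samples at most `t` phases are complete, so `t + 1` phases never run out. Thus the
learner needs no a priori bound on the number of phases. -/
lemma IsPhased.replay_eq {E : Type} {Q : ℕ → Strategy E (Option E)} (hQ : IsPhased Q) {F t : ℕ}
    {s : CoinTable} {v : ℕ → ℝ} (h : ∀ r, (Q F).replay s 0 v 0 t ≠ Sum.inr (none, r)) :
    (Q (t + 1)).replay s 0 v 0 t = (Q F).replay s 0 v 0 t := by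
  rcases le_total F (t + 1) with hF | hF
  · rcases hQ.agree F (t + 1) s v t hF with ⟨r, hr⟩ | h1
    · exact absurd hr (h r)
    · exact h1.symm
  · rcases hQ.agree (t + 1) F s v t hF with ⟨r, hr⟩ | h1
    · have := hQ.le_of_none _ _ _ _ _ hr
      omega
    · exact h1

/-- By induction the history after `t` rounds is the reversed prefix of the trace of `Q F`; at the
end of the trace the replay reaches the result. -/
lemma returnsWithin_ofStrategies {Q : ℕ → Strategy (Fin n × Fin m) (Option (Fin n × Fin m))}
    (hQ : IsPhased Q) (s : CoinTable) (x : Fin n × Fin m → ℕ → ℝ) {b : Fin n × Fin m} {F : ℕ}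
    {N : ℝ} (hb : (Q F).result s 0 x 0 = some b) (hN : ((Q F).trace s 0 x 0).length ≤ N) :
    (ofStrategies Q).ReturnsWithin s x b N := by
  have hv : ∀ t, ∀ k (hk : k < ((Q F).trace s 0 x 0).length), k < t →
      ((((Q F).trace s 0 x 0).take t).reverse.reverse.map Prod.snd).getD (0 + k) 0
        = ((Q F).trace s 0 x 0)[k].2 := by
    intro t k hk hkt
    rw [zero_add, List.getD_eq_getElem _ _ (by simp; omega)]
    simp
  have hhist : ∀ t ≤ ((Q F).trace s 0 x 0).length,
      (ofStrategies Q).history s x t = (((Q F).trace s 0 x 0).take t).reverse := by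
    intro t ht
    induction t with
    | zero => simp [history]
    | succ t ih =>
      have ih := ih (by omega)
      have hlt : t < ((Q F).trace s 0 x 0).length := by omega
      have h1 := replay_eq_inl (Q F) s 0 x 0
        (fun k => ((((Q F).trace s 0 x 0).take t).reverse.reverse.map Prod.snd).getD k 0) 0 t hlt
        (hv t)
      rw [zero_add] at h1
      have h2 := hQ.replay_eq (F := F) (t := t) (fun r hr => by rw [h1] at hr; cases hr)
      have hact : (ofStrategies Q).act s ((ofStrategies Q).history s x t)
          = Sum.inl ((Q F).trace s 0 x 0)[t].1 := by
        rw [ih]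
        simp only [ofStrategies]
        rw [List.length_reverse, List.length_take, min_eq_left hlt.le, h2, h1]
        rfl
      rw [ih] at hact
      simp only [history, ih, hact]
      rw [List.take_succ_eq_append_getElem hlt, List.reverse_append, List.reverse_singleton,
        List.singleton_append]
      congr 1
      refine Prod.ext rfl ?_
      rw [getElem_trace_snd, List.map_reverse, List.count_reverse, Pi.zero_apply, zero_add]
      congr!
  refine ⟨((Q F).trace s 0 x 0).length, ?_, ?_⟩
  · have h1 := replay_eq_inr (Q F) s 0 x 0
      (fun k => ((((Q F).trace s 0 x 0).take ((Q F).trace s 0 x 0).length).reverse.reverse.map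
        Prod.snd).getD k 0) 0 _ (zero_add _).symm (fun k hk => hv _ k hk hk)
    obtain ⟨r, hr⟩ := h1
    rw [hb] at hr
    have h2 := hQ.replay_eq (F := F) (fun r' hr' => by rw [hr] at hr'; simp at hr')
    rw [hhist _ le_rfl]
    simp only [ofStrategies]
    rw [List.length_reverse, List.length_take, min_self, h2, hr]
    rfl
  · rw [hhist _ le_rfl]
    simpa using hN

end Learner

/-! ### The algorithm and the accuracy of its tests. -/

namespace Equilibrium

open Strategy

/-- The accuracy to which the value of the matrix is known at the beginning of phase `r`. -/
noncomputable def width (r : ℕ) : ℝ := 2 * (3 / 4) ^ r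

/-- The number of samples that estimate an entry in phase `r` with constant probability. -/
noncomputable def samples (r : ℕ) : ℕ := ⌈160 / width r ^ 2⌉₊

/-- The number of repetitions that make the error probability in phase `r` small. -/
noncomputable def reps (n m : ℕ) (δ : ℝ) (r : ℕ) : ℕ :=
  ⌈100 * Real.log ((n : ℝ) * m * (r + 2) / δ)⌉₊ + 1

/-- The number of rounds of elimination in each phase. -/
def rounds (n m : ℕ) : ℕ := 5 * (Nat.log 2 (n * m) + 1)

/-- The remaining rows, the remaining columns, and a lower bound for the value of the matrix. -/
abbrev State (n m : ℕ) : Type := List (Fin n) × List (Fin m) × ℝ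

/-- Eliminate columns with entries that are larger than the value. -/
noncomputable def reduceColumns {n m : ℕ} (N t K : ℕ) (lo w : ℝ) (R : List (Fin n))
    (S : List (Fin m)) : Strategy (Fin n × Fin m) (List (Fin m)) :=
  eliminateRounds (fun i j => test (i, j) N (lo + 4 * w) fun b => ret !b)
    (fun i j => test (i, j) N (lo + 2 * w) fun b => ret b) t R K S

/-- Eliminate rows with entries that are smaller than the value. -/
noncomputable def reduceRows {n m : ℕ} (N t K : ℕ) (lo w : ℝ) (S : List (Fin m))
    (R : List (Fin n)) : Strategy (Fin n × Fin m) (List (Fin n)) :=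
  eliminateRounds (fun j i => test (i, j) N (lo - 3 * w) fun b => ret b)
    (fun j i => test (i, j) N (lo - w) fun b => ret !b) t S K R

/-- One phase of the algorithm: improve the accuracy of the value, and eliminate columns and
rows. -/
noncomputable def phase (n m : ℕ) (δ : ℝ) (r : ℕ) (σ : State n m) :
    Strategy (Fin n × Fin m) (State n m) :=
  (compareValue (fun i j => test (i, j) (samples r * reps n m δ r) (σ.2.2 + width r / 2)
      fun b => ret b) σ.1 σ.2.1).bind fun b =>
    (reduceColumns (samples r) (reps n m δ r) (rounds n m)
        (if b then σ.2.2 + width r / 4 else σ.2.2) (width (r + 1)) σ.1 σ.2.1).bind fun S =>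
      (reduceRows (samples r) (reps n m δ r) (rounds n m)
        (if b then σ.2.2 + width r / 4 else σ.2.2) (width (r + 1)) S σ.1).bind fun R =>
          ret (R, S, if b then σ.2.2 + width r / 4 else σ.2.2)

/-- At most `F` phases of the algorithm, beginning with phase `r`.  The result is `none` if there
are phases left. -/
noncomputable def run (n m : ℕ) [NeZero n] [NeZero m] (δ : ℝ) :
    ℕ → ℕ → State n m → Strategy (Fin n × Fin m) (Option (Fin n × Fin m))
  | 0, _, _ => ret none
  | F + 1, r, σ =>
    if σ.1 ≠ [] ∧ σ.2.1 ≠ [] ∧ 3 ≤ σ.1.length + σ.2.1.length then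
      (phase n m δ r σ).bind (run n m δ F (r + 1))
    else ret (some (σ.1.headD 0, σ.2.1.headD 0))

/-- The algorithm, with at most `F` phases. -/
noncomputable def algorithm (n m : ℕ) [NeZero n] [NeZero m] (δ : ℝ) (F : ℕ) :
    Strategy (Fin n × Fin m) (Option (Fin n × Fin m)) :=
  run n m δ F 0 (List.finRange n, List.finRange m, -1)

lemma width_pos (r : ℕ) : 0 < width r := by unfold width; positivity

lemma width_succ (r : ℕ) : width (r + 1) = 3 / 4 * width r := by unfold width; ring

lemma samples_pos (r : ℕ) : 0 < samples r := by
  have := width_pos r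
  exact Nat.ceil_pos.2 (by positivity)

section Phased

variable {n m : ℕ} {δ : ℝ}

/-- A phase opens with a test of `samples r * reps n m δ r` samples, which is positive thanks to the
`+ 1` in `reps`. -/
lemma lt_pos_of_replay_phase_eq {r : ℕ} {σ : State n m} (hR : σ.1 ≠ []) (hS : σ.2.1 ≠ [])
    {s : CoinTable} {c : ℕ} {v : ℕ → ℝ} {pos t : ℕ} {q : State n m × ℕ × ℕ}
    (h : (phase n m δ r σ).replay s c v pos t = Sum.inr q) : pos < q.2.2 := by
  obtain ⟨R, S, lo⟩ := σ
  obtain ⟨i, R, rfl⟩ := List.exists_cons_of_ne_nil hR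
  obtain ⟨j, S, rfl⟩ := List.exists_cons_of_ne_nil hS
  have hpos : 0 < samples r * reps n m δ r := Nat.mul_pos (samples_pos r) (Nat.succ_pos _)
  unfold phase at h
  simp only [compareValue, Strategy.bind, replay] at h
  by_cases ht : t < pos + samples r * reps n m δ r
  · rw [if_pos ht] at h
    cases h
  rw [if_neg ht] at h
  have := (pos_le_of_replay_eq _ s c v (by omega) h).1
  omega

variable [NeZero n] [NeZero m]

lemma replay_run_agree (F F' r : ℕ) (σ : State n m) (s : CoinTable) (c : ℕ) (v : ℕ → ℝ)
    (pos t : ℕ) (hF : F ≤ F') :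
    (∃ q, (run n m δ F r σ).replay s c v pos t = Sum.inr (none, q)) ∨
      (run n m δ F r σ).replay s c v pos t = (run n m δ F' r σ).replay s c v pos t := by
  induction F generalizing F' r σ c pos with
  | zero => exact Or.inl ⟨_, rfl⟩
  | succ F ih =>
    obtain ⟨F', rfl⟩ : ∃ k, F' = k + 1 := ⟨F' - 1, by omega⟩
    simp only [run]
    split_ifs
    · simp only [replay_bind]
      cases (phase n m δ r σ).replay s c v pos t with
      | inl e => exact Or.inr rfl
      | inr q => exact ih F' (r + 1) q.1 q.2.1 q.2.2 (by omega)
    · exact Or.inr rfl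

lemma add_le_of_replay_run_eq (F r : ℕ) (σ : State n m) (s : CoinTable) (c : ℕ) (v : ℕ → ℝ)
    (pos t : ℕ) (hpos : pos ≤ t) (q : ℕ × ℕ)
    (h : (run n m δ F r σ).replay s c v pos t = Sum.inr (none, q)) : pos + F ≤ t := by
  induction F generalizing r σ c pos with
  | zero => exact hpos
  | succ F ih =>
    simp only [run] at h
    split_ifs at h with hσ
    · simp only [replay_bind] at h
      cases hq : (phase n m δ r σ).replay s c v pos t with
      | inl e => rw [hq] at h; simp at h
      | inr q' =>
        rw [hq] at h
        have h1 := lt_pos_of_replay_phase_eq hσ.1 hσ.2.1 hq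
        have h2 := (pos_le_of_replay_eq _ s c v hpos hq).2
        have := ih _ _ _ _ h2 h
        omega
    · simp [replay] at h

lemma isPhased_algorithm : Learner.IsPhased (algorithm n m δ) where
  agree F F' s v t hF := replay_run_agree F F' 0 _ s 0 v 0 t hF
  le_of_none F s v t q h := by
    have := add_le_of_replay_run_eq F 0 _ s 0 v 0 t (Nat.zero_le _) q h
    omega

end Phased

lemma hundred_le_exp_five : (100 : ℝ) ≤ Real.exp 5 := by
  have := Real.exp_one_gt_d9
  have h : Real.exp 5 = Real.exp 1 ^ 5 := by rw [← Real.exp_nat_mul]; norm_num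
  rw [h]
  calc (100 : ℝ) ≤ (27 / 10) ^ 5 := by norm_num
    _ ≤ _ := by gcongr; linarith

/-- Here 160 = 32 · 5 is used: the exponent is at least N w² / 32 ≥ 5t, and e⁵ ≥ 100. -/
lemma exp_neg_le_of_accurate {N : ℕ} {w x : ℝ} {t : ℕ} (hw : 0 < w)
    (hN : 160 * t ≤ N * w ^ 2) (hx : w / 4 ≤ x) :
    Real.exp (-(N * x ^ 2 / 2)) ≤ (1 / 100) ^ t := by
  have h1 : (5 : ℝ) * t ≤ N * x ^ 2 / 2 := by
    have : (w / 4) ^ 2 ≤ x ^ 2 := by gcongr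
    have : N * (w / 4) ^ 2 ≤ N * x ^ 2 := by gcongr
    linarith [this]
  have h2 := hundred_le_exp_five
  calc Real.exp (-(N * x ^ 2 / 2)) ≤ Real.exp (-(5 * t)) := by gcongr
    _ = (Real.exp 5)⁻¹ ^ t := by rw [← Real.exp_neg, ← Real.exp_nat_mul]; ring_nf
    _ ≤ (1 / 100) ^ t := by
      gcongr
      rw [one_div]
      gcongr

lemma le_samples_mul (r : ℕ) : 160 ≤ samples r * width r ^ 2 := by
  have := width_pos r
  have h : 160 / width r ^ 2 ≤ samples r := Nat.le_ceil _
  rwa [div_le_iff₀ (by positivity)] at h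

section Analysis

variable {n m : ℕ} {A : Matrix (Fin n) (Fin m) ℝ}

lemma tailUpper_le_of_accurate {v θ w : ℝ} {N t : ℕ} (hw : 0 < w) (hN : 160 * t ≤ N * w ^ 2)
    (h : v + w / 4 ≤ θ) : tailUpper v N θ ≤ (1 / 100) ^ t := by
  rw [tailUpper, if_pos (by linarith)]
  exact exp_neg_le_of_accurate hw hN (by linarith)

lemma tailLower_ge_of_accurate {v θ w : ℝ} {N t : ℕ} (hw : 0 < w) (hN : 160 * t ≤ N * w ^ 2)
    (h : θ + w / 4 ≤ v) : 1 - tailLower v N θ ≤ (1 / 100) ^ t := by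
  rw [tailLower, if_pos (by linarith), sub_sub_cancel]
  exact exp_neg_le_of_accurate hw hN (by linarith)

lemma failure_test_eq_of_le {E : Type} {B : E → ℝ} {e : E} {N : ℕ} {θ w : ℝ} {g : Bool → Bool}
    (hw : 0 < w) (hN : 160 ≤ N * w ^ 2) (h : B e + w / 4 ≤ θ) :
    (test e N θ fun b => ret (g b)).failure B (fun b _ => b = g false) ≤ 1 / 100 := by
  refine (failure_mono _ fun b c hb => hb.1).trans
    (failure_test_le (p := fun b => b = g false) (by norm_num) (Or.inr rfl) (fun _ => ?_)
      (fun h => absurd rfl h))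
  simpa using tailUpper_le_of_accurate (t := 1) hw (by simpa using hN) h

lemma failure_test_eq_of_ge {E : Type} {B : E → ℝ} {e : E} {N : ℕ} {θ w : ℝ} {g : Bool → Bool}
    (hw : 0 < w) (hN : 160 ≤ N * w ^ 2) (h : θ + w / 4 ≤ B e) :
    (test e N θ fun b => ret (g b)).failure B (fun b _ => b = g true) ≤ 1 / 100 := by
  refine (failure_mono _ fun b c hb => hb.1).trans
    (failure_test_le (p := fun b => b = g true) (by norm_num) (Or.inl rfl)
      (fun h => absurd rfl h) (fun _ => ?_))
  simpa using tailLower_ge_of_accurate (t := 1) hw (by simpa using hN) h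

lemma failure_test_cost {E : Type} {B : E → ℝ} {e : E} {N : ℕ} {θ : ℝ} {g : Bool → Bool} :
    (test e N θ fun b => ret (g b)).failure B (fun _ c => c ≤ N) ≤ 0 :=
  (failure_mono _ fun b c hb => hb.2).trans
    (failure_test_le (p := fun _ => True) le_rfl (Or.inl trivial) (by simp) (by simp))

/-- The thresholds lie halfway between the levels `lo + w`, `lo + 3 * w`, `lo + 5 * w`. The margin
`w` is a quarter of the accuracy `4 * w` assumed of `N`. -/
lemma isTestPair_columns {N : ℕ} {lo w : ℝ} (hw : 0 < w) (hN : 160 ≤ N * (4 * w) ^ 2) :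
    IsTestPair (fun e : Fin n × Fin m => A e.1 e.2)
      (fun i j => test (i, j) N (lo + 4 * w) fun b => ret !b)
      (fun i j => test (i, j) N (lo + 2 * w) fun b => ret b)
      (fun i j => lo + 5 * w ≤ A i j) (fun i j => lo + 3 * w ≤ A i j)
      (fun i j => A i j ≤ lo + w) N where
  fst_far i j h := failure_test_eq_of_ge (g := fun b => !b) (w := 4 * w) (by positivity) hN (by dsimp only; linarith)
  fst_good i j h := failure_test_eq_of_le (g := fun b => !b) (w := 4 * w) (by positivity) hN
    (by dsimp only; linarith [not_le.1 h])
  fst_cost i j := failure_test_cost (g := fun b => !b)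
  snd_low i j h := failure_test_eq_of_le (g := fun b => b) (w := 4 * w) (by positivity) hN (by dsimp only; linarith)
  snd_good i j h := failure_test_eq_of_ge (g := fun b => b) (w := 4 * w) (by positivity) hN (by dsimp only; linarith)
  snd_cost i j := failure_test_cost (g := fun b => b)

/-- The levels start at `lo`, the known lower bound of the value. As the value may be `lo + w`, an
entry that is not far again has a gap below `5 * w`. -/
lemma isTestPair_rows {N : ℕ} {lo w : ℝ} (hw : 0 < w) (hN : 160 ≤ N * (4 * w) ^ 2) :
    IsTestPair (fun e : Fin n × Fin m => A e.1 e.2)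
      (fun j i => test (i, j) N (lo - 3 * w) fun b => ret b)
      (fun j i => test (i, j) N (lo - w) fun b => ret !b)
      (fun j i => A i j ≤ lo - 4 * w) (fun j i => A i j ≤ lo - 2 * w)
      (fun j i => lo ≤ A i j) N where
  fst_far j i h := failure_test_eq_of_le (g := fun b => b) (w := 4 * w) (by positivity) hN (by dsimp only; linarith)
  fst_good j i h := failure_test_eq_of_ge (g := fun b => b) (w := 4 * w) (by positivity) hN
    (by dsimp only; linarith [not_le.1 h])
  fst_cost j i := failure_test_cost (g := fun b => b)
  snd_low j i h := failure_test_eq_of_ge (g := fun b => !b) (w := 4 * w) (by positivity) hN (by dsimp only; linarith)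
  snd_good j i h := failure_test_eq_of_le (g := fun b => !b) (w := 4 * w) (by positivity) hN (by dsimp only; linarith)
  snd_cost j i := failure_test_cost (g := fun b => !b)

end Analysis

end Equilibrium

/-! ### The invariant, and the analysis of the phases. -/

lemma List.Nodup.countP_le_card {α : Type*} [DecidableEq α] {l : List α} (h : l.Nodup)
    (p : α → Bool) (s : Finset α) (hs : ∀ a, p a → a ∈ s) : l.countP p ≤ s.card := by
  rw [List.countP_eq_length_filter, ← List.toFinset_card_of_nodup (h.filter p)]
  refine Finset.card_le_card fun a ha => hs a ?_
  simp only [List.mem_toFinset, List.mem_filter] at ha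
  exact ha.2

namespace Equilibrium

open Strategy

variable {n m : ℕ} {A : Matrix (Fin n) (Fin m) ℝ} {i₀ : Fin n} {j₀ : Fin m}

/-- The other rows whose entry in the column of the equilibrium is close to its value. -/
noncomputable def nearRows (A : Matrix (Fin n) (Fin m) ℝ) (i₀ : Fin n) (j₀ : Fin m) (w : ℝ) : ℕ :=
  ((Finset.univ.erase i₀).filter fun i => A i₀ j₀ - A i j₀ < 5 * w).card

/-- The other columns whose entry in the row of the equilibrium is close to its value. -/
noncomputable def nearCols (A : Matrix (Fin n) (Fin m) ℝ) (i₀ : Fin n) (j₀ : Fin m) (w : ℝ) : ℕ :=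
  ((Finset.univ.erase j₀).filter fun j => A i₀ j - A i₀ j₀ < 5 * w).card

/-- Since 2 · 6⁵ < 7⁵, five rounds at least halve a list. -/
lemma six_pow_rounds_mul_lt (n m : ℕ) :
    6 ^ rounds n m * (n * m) < 7 ^ rounds n m := by
  unfold rounds
  have h : n * m < 2 ^ (Nat.log 2 (n * m) + 1) := Nat.lt_pow_succ_log_self one_lt_two (n * m)
  generalize Nat.log 2 (n * m) + 1 = l at h
  calc 6 ^ (5 * l) * (n * m) < 6 ^ (5 * l) * 2 ^ l := by gcongr
    _ = (6 ^ 5 * 2) ^ l := by rw [mul_pow, pow_mul]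
    _ ≤ (7 ^ 5) ^ l := by gcongr; norm_num
    _ = 7 ^ (5 * l) := by rw [pow_mul]

lemma length_lt_of_rounds {β : Type} {S S' : List β} {k b : ℕ} (hk : S.length ≤ n * m)
    (hS' : 0 < S'.length) (hkb : k ≤ b)
    (h : S'.length < 2 * k ∨ 7 ^ rounds n m * S'.length ≤ 6 ^ rounds n m * S.length) :
    S'.length < 2 * b := by
  rcases h with h | h
  · omega
  · have h1 := six_pow_rounds_mul_lt n m
    have h2 : 7 ^ rounds n m * 1 ≤ 7 ^ rounds n m * S'.length := by gcongr; omega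
    have h3 : 6 ^ rounds n m * S.length ≤ 6 ^ rounds n m * (n * m) := by gcongr
    omega

lemma failure_reduceColumns_le [NeZero n] {N : ℕ} (t : ℕ) {lo w : ℝ} (hA : IsStrictPSNE A i₀ j₀)
    (hw : 0 < w) (hN : 160 ≤ N * (4 * w) ^ 2) (hlo : lo ≤ A i₀ j₀) (hlo' : A i₀ j₀ ≤ lo + w)
    {R : List (Fin n)} {S : List (Fin m)} (hi : i₀ ∈ R) (hj : j₀ ∈ S) (hS : S.Nodup) :
    (reduceColumns N t (rounds n m) lo w R S).failure (fun e => A e.1 e.2)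
      (fun S' c => (S'.Nodup ∧ j₀ ∈ S' ∧ S'.length < 2 * (nearCols A i₀ j₀ w + 1) ∧
        S'.length ≤ S.length) ∧ c ≤ rounds n m * ((R.length + S.length) * (16 * t * N)))
      ≤ rounds n m * ((R.length + S.length) * (2 * (9 / 10) ^ t)) := by
  classical
  have hlow : ∀ i, A i j₀ ≤ lo + w := by
    intro i
    by_cases hi : i = i₀
    · subst hi; exact hlo'
    · exact (hA.1 i hi).le.trans hlo'
  refine le_trans (failure_mono _ ?_) (failure_eliminateRounds_le
    (isTestPair_columns (A := A) (lo := lo) hw hN) t hi hlow (rounds n m) hj)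
  rintro S' c ⟨⟨h1, h2, h3⟩, hc⟩
  refine ⟨⟨h1.nodup hS, h2, ?_, h1.length_le⟩, hc⟩
  refine length_lt_of_rounds ?_ (List.length_pos_of_mem h2) ?_ h3
  · have := hS.length_le_card
    rw [Fintype.card_fin] at this
    exact this.trans (Nat.le_mul_of_pos_left _ (NeZero.pos n))
  -- Column `j₀` itself is not far, hence the `+ 1`.
  · refine (hS.countP_le_card _ (insert j₀ ((Finset.univ.erase j₀).filter
      fun j => A i₀ j - A i₀ j₀ < 5 * w)) fun j hj => ?_).trans (Finset.card_insert_le _ _)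
    simp only [decide_eq_true_eq, not_le] at hj
    by_cases hjj : j = j₀
    · simp [hjj]
    · simp only [Finset.mem_insert, Finset.mem_filter, Finset.mem_erase, Finset.mem_univ]
      exact Or.inr ⟨⟨hjj, trivial⟩, by linarith⟩

lemma failure_reduceRows_le [NeZero m] {N : ℕ} (t : ℕ) {lo w : ℝ} (hA : IsStrictPSNE A i₀ j₀)
    (hw : 0 < w) (hN : 160 ≤ N * (4 * w) ^ 2) (hlo : lo ≤ A i₀ j₀) (hlo' : A i₀ j₀ ≤ lo + w)
    {S : List (Fin m)} {R : List (Fin n)} (hj : j₀ ∈ S) (hi : i₀ ∈ R) (hR : R.Nodup) :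
    (reduceRows N t (rounds n m) lo w S R).failure (fun e => A e.1 e.2)
      (fun R' c => (R'.Nodup ∧ i₀ ∈ R' ∧ R'.length < 2 * (nearRows A i₀ j₀ w + 1) ∧
        R'.length ≤ R.length) ∧ c ≤ rounds n m * ((S.length + R.length) * (16 * t * N)))
      ≤ rounds n m * ((S.length + R.length) * (2 * (9 / 10) ^ t)) := by
  classical
  have hlow : ∀ j, lo ≤ A i₀ j := by
    intro j
    by_cases hj : j = j₀
    · subst hj; exact hlo
    · exact hlo.trans (hA.2 j hj).le
  refine le_trans (failure_mono _ ?_) (failure_eliminateRounds_le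
    (isTestPair_rows (A := A) (lo := lo) hw hN) t hj hlow (rounds n m) hi)
  rintro R' c ⟨⟨h1, h2, h3⟩, hc⟩
  refine ⟨⟨h1.nodup hR, h2, ?_, h1.length_le⟩, hc⟩
  refine length_lt_of_rounds ?_ (List.length_pos_of_mem h2) ?_ h3
  · have := hR.length_le_card
    rw [Fintype.card_fin] at this
    exact this.trans (Nat.le_mul_of_pos_right _ (NeZero.pos m))
  · refine (hR.countP_le_card _ (insert i₀ ((Finset.univ.erase i₀).filter
      fun i => A i₀ j₀ - A i j₀ < 5 * w)) fun i hi => ?_).trans (Finset.card_insert_le _ _)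
    simp only [decide_eq_true_eq, not_le] at hi
    by_cases hii : i = i₀
    · simp [hii]
    · simp only [Finset.mem_insert, Finset.mem_filter, Finset.mem_erase, Finset.mem_univ]
      exact Or.inr ⟨⟨hii, trivial⟩, by linarith⟩

/-- The invariant at the beginning of phase `r`. -/
structure Invariant (A : Matrix (Fin n) (Fin m) ℝ) (i₀ : Fin n) (j₀ : Fin m) (r : ℕ)
    (σ : State n m) : Prop where
  nodup_rows : σ.1.Nodup
  nodup_cols : σ.2.1.Nodup
  mem_rows : i₀ ∈ σ.1
  mem_cols : j₀ ∈ σ.2.1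
  lower_le : σ.2.2 ≤ A i₀ j₀
  le_upper : A i₀ j₀ ≤ σ.2.2 + width r
  rows_lt : σ.1.length < 2 * (nearRows A i₀ j₀ (width r) + 1)
  cols_lt : σ.2.1.length < 2 * (nearCols A i₀ j₀ (width r) + 1)

/-- Both answers are acceptable if the value lies in the middle half of the interval. A harmful
outcome therefore requires the empirical mean to be off by more than `w / 4`. -/
lemma failure_compareValue_test_le {t N : ℕ} {lo w : ℝ} (hA : IsStrictPSNE A i₀ j₀) (hw : 0 < w)
    (hN : 160 * t ≤ N * w ^ 2) {R : List (Fin n)} {S : List (Fin m)} (hi : i₀ ∈ R) (hj : j₀ ∈ S) :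
    (compareValue (fun i j => test (i, j) N (lo + w / 2) fun b => ret b) R S).failure
      (fun e : Fin n × Fin m => A e.1 e.2)
      (fun b c => ((b = false → A i₀ j₀ ≤ lo + 3 * w / 4) ∧ (b = true → lo + w / 4 ≤ A i₀ j₀)) ∧
        c ≤ (R.length + S.length) * N) ≤ (R.length + S.length) * (9 / 10) ^ t := by
  refine failure_compareValue_le (i₀ := i₀) (j₀ := j₀) (by positivity) (fun i j => ?_) R S
    (Or.inl hi) (Or.inl hj)
  have hpow : (1 / 100 : ℝ) ^ t ≤ (9 / 10) ^ t := pow_le_pow_left₀ (by norm_num) (by norm_num) t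
  have hij : i = i₀ → A i₀ j₀ ≤ A i j := by
    rintro rfl
    by_cases h : j = j₀
    · rw [h]
    · exact (hA.2 j h).le
  have hji : j = j₀ → A i j ≤ A i₀ j₀ := by
    rintro rfl
    by_cases h : i = i₀
    · rw [h]
    · exact (hA.1 i h).le
  refine failure_test_le (g := fun b => b) (p := fun b =>
    (b = false → i = i₀ → A i₀ j₀ ≤ lo + 3 * w / 4) ∧
      (b = true → j = j₀ → lo + w / 4 ≤ A i₀ j₀)) (by positivity) ?_ ?_ ?_
  -- The outcome that reports the true side of the threshold is always harmless.
  · rcases le_total (A i j) (lo + w / 2) with h | h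
    · refine Or.inr ⟨fun _ hi => ?_, by simp⟩
      have := hij hi
      linarith
    · refine Or.inl ⟨by simp, fun _ hj => ?_⟩
      have := hji hj
      linarith
  · intro h
    simp only [Bool.true_eq_false, false_imp_iff, true_and, forall_const, not_forall,
      not_le] at h
    obtain ⟨hj, h⟩ := h
    have := hji hj
    exact (tailUpper_le_of_accurate hw hN (by dsimp only; linarith)).trans hpow
  · intro h
    simp only [Bool.false_eq_true, false_imp_iff, and_true, forall_const, not_forall,
      not_le] at h
    obtain ⟨hi, h⟩ := h
    have := hij hi
    exact (tailLower_ge_of_accurate hw hN (by dsimp only; linarith)).trans hpow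

/-- In `1 + 4 * rounds n m` the comparison accounts for 1 and each of the two reductions for `2 *
rounds n m`; the cost splits in the same way. -/
lemma failure_phase_le [NeZero n] [NeZero m] (δ : ℝ) (hA : IsStrictPSNE A i₀ j₀) {r : ℕ}
    {σ : State n m} (hσ : Invariant A i₀ j₀ r σ) :
    (phase n m δ r σ).failure (fun e => A e.1 e.2)
      (fun σ' c => Invariant A i₀ j₀ (r + 1) σ' ∧ c ≤ (σ.1.length + σ.2.1.length) *
        (samples r * reps n m δ r * (1 + 32 * rounds n m)))
      ≤ (n + m) * ((1 + 4 * rounds n m) * (9 / 10) ^ reps n m δ r) := by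
  have hw := width_pos r
  have hw' := width_pos (r + 1)
  have hsamp := le_samples_mul r
  have hlenR : σ.1.length ≤ n := by simpa using hσ.nodup_rows.length_le_card
  have hlenS : σ.2.1.length ≤ m := by simpa using hσ.nodup_cols.length_le_card
  have hN : (160 : ℝ) * reps n m δ r ≤ (samples r * reps n m δ r : ℕ) * width r ^ 2 := by
    push_cast
    calc (160 : ℝ) * reps n m δ r ≤ samples r * width r ^ 2 * reps n m δ r := by gcongr
      _ = _ := by ring
  -- As `4 * width (r + 1) = 3 * width r`, the samples for the old width are enough.
  have hN' : (160 : ℝ) ≤ samples r * (4 * width (r + 1)) ^ 2 := by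
    rw [width_succ]; nlinarith
  set t := reps n m δ r
  set N := samples r
  set K := rounds n m
  have hnm : (0 : ℝ) ≤ n + m := by positivity
  have hsplit : ((n : ℝ) + m) * ((1 + 4 * K) * (9 / 10) ^ t) = (n + m) * (9 / 10) ^ t
      + (K * ((n + m) * (2 * (9 / 10) ^ t)) + (K * ((n + m) * (2 * (9 / 10) ^ t)) + 0)) := by ring
  rw [hsplit]
  have hR' : (σ.1.length : ℝ) ≤ n := by exact_mod_cast hlenR
  have hS' : (σ.2.1.length : ℝ) ≤ m := by exact_mod_cast hlenS
  refine failure_bind_le ((failure_compareValue_test_le (lo := σ.2.2) hA hw hN hσ.mem_rows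
    hσ.mem_cols).trans (by gcongr)) (by positivity) fun b c hb => ?_
  obtain ⟨⟨hb1, hb2⟩, hc⟩ := hb
  have hlo : (if b then σ.2.2 + width r / 4 else σ.2.2) ≤ A i₀ j₀ := by
    cases b
    · simpa using hσ.lower_le
    · simpa using hb2 rfl
  have hhi : A i₀ j₀ ≤ (if b then σ.2.2 + width r / 4 else σ.2.2) + width (r + 1) := by
    rw [width_succ]
    cases b
    · have := hb1 rfl
      simp only [Bool.false_eq_true, if_false]
      linarith
    · have := hσ.le_upper
      simp only [if_true]
      linarith
  refine failure_bind_le ((failure_reduceColumns_le t hA hw' hN' hlo hhi hσ.mem_rows hσ.mem_cols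
    hσ.nodup_cols).trans (by gcongr)) (by positivity) fun S c₁ hS => ?_
  obtain ⟨⟨hS1, hS2, hS3, hS4⟩, hc₁⟩ := hS
  have hS4' : (S.length : ℝ) ≤ m := by exact_mod_cast hS4.trans hlenS
  refine failure_bind_le ((failure_reduceRows_le t hA hw' hN' hlo hhi hS2 hσ.mem_rows
    hσ.nodup_rows).trans (by rw [add_comm (S.length : ℝ)]; gcongr)) le_rfl fun R c₂ hR => ?_
  obtain ⟨⟨hR1, hR2, hR3, hR4⟩, hc₂⟩ := hR
  refine failure_ret_le ⟨⟨hR1, hS1, hR2, hS2, hlo, hhi, hR3, hS3⟩, ?_⟩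
  calc c + (c₁ + (c₂ + 0)) ≤ (σ.1.length + σ.2.1.length) * (N * t)
        + (K * ((σ.1.length + σ.2.1.length) * (16 * t * N))
          + K * ((S.length + σ.1.length) * (16 * t * N))) :=
        add_le_add hc (add_le_add hc₁ hc₂)
    _ ≤ (σ.1.length + σ.2.1.length) * (N * t)
        + (K * ((σ.1.length + σ.2.1.length) * (16 * t * N))
          + K * ((σ.2.1.length + σ.1.length) * (16 * t * N))) := by gcongr
    _ = _ := by ring

/-- A bound for the number of samples in phase `r`. -/
noncomputable def phaseCost (A : Matrix (Fin n) (Fin m) ℝ) (i₀ : Fin n) (j₀ : Fin m) (δ : ℝ)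
    (r : ℕ) : ℕ :=
  4 * (nearRows A i₀ j₀ (width r) + nearCols A i₀ j₀ (width r)) *
    (samples r * reps n m δ r * (1 + 32 * rounds n m))

lemma failure_run_of_length_le [NeZero n] [NeZero m] {r : ℕ} {σ : State n m}
    (hσ : Invariant A i₀ j₀ r σ) (hlen : σ.1.length + σ.2.1.length ≤ 2) (F : ℕ) (δ : ℝ) {C : ℕ} :
    (run n m δ (F + 1) r σ).failure (fun e => A e.1 e.2)
      (fun o c => o = some (i₀, j₀) ∧ c ≤ C) ≤ 0 := by
  obtain ⟨R, S, lo⟩ := σ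
  have hi : i₀ ∈ R := hσ.mem_rows
  have hj : j₀ ∈ S := hσ.mem_cols
  have hR := List.length_pos_of_mem hi
  have hS := List.length_pos_of_mem hj
  simp only at hlen
  obtain ⟨i, rfl⟩ := List.length_eq_one_iff.1 (by omega : R.length = 1)
  obtain ⟨j, rfl⟩ := List.length_eq_one_iff.1 (by omega : S.length = 1)
  obtain rfl : i₀ = i := by simpa using hi
  obtain rfl : j₀ = j := by simpa using hj
  rw [run, if_neg (by simp)]
  exact failure_ret_le ⟨rfl, Nat.zero_le _⟩

/-- When nothing is near any more, the invariant forces both lists to be singletons; the extra unit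
of fuel is needed to return them. -/
lemma failure_run_le [NeZero n] [NeZero m] {δ : ℝ} (hA : IsStrictPSNE A i₀ j₀) (ε : ℕ → ℝ)
    (hε : ∀ r, (n + m : ℝ) * ((1 + 4 * rounds n m) * (9 / 10) ^ reps n m δ r) ≤ ε r)
    (F r : ℕ) (hF : nearRows A i₀ j₀ (width (r + F)) + nearCols A i₀ j₀ (width (r + F)) = 0)
    {σ : State n m} (hσ : Invariant A i₀ j₀ r σ) :
    (run n m δ (F + 1) r σ).failure (fun e => A e.1 e.2)
      (fun o c => o = some (i₀, j₀) ∧ c ≤ ∑ q ∈ Finset.range F, phaseCost A i₀ j₀ δ (r + q))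
      ≤ ∑ q ∈ Finset.range F, ε (r + q) := by
  have hε0 : ∀ r, 0 ≤ ε r := fun r => le_trans (by positivity) (hε r)
  induction F generalizing r σ with
  | zero =>
    have hRlt := hσ.rows_lt
    have hSlt := hσ.cols_lt
    rw [add_zero] at hF
    exact (failure_run_of_length_le hσ (by omega) 0 δ).trans (by simp)
  | succ F ih =>
    by_cases hcont : 3 ≤ σ.1.length + σ.2.1.length
    · have hRlt := hσ.rows_lt
      have hSlt := hσ.cols_lt
      rw [run, if_pos ⟨List.ne_nil_of_mem hσ.mem_rows, List.ne_nil_of_mem hσ.mem_cols, hcont⟩,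
        Finset.sum_range_succ', Finset.sum_range_succ',
        add_comm (∑ q ∈ Finset.range F, ε (r + (q + 1)))]
      refine failure_bind_le ((failure_phase_le δ hA hσ).trans (hε r))
        (Finset.sum_nonneg fun q _ => hε0 _) fun σ' c hσ' => ?_
      obtain ⟨hσ', hc⟩ := hσ'
      -- At least three rows and columns remain, so something is near, and the total length is at
      -- most 2 · near + 2 ≤ 4 · near.
      have hc' : c ≤ phaseCost A i₀ j₀ δ (r + 0) := by
        refine hc.trans ?_
        rw [add_zero, phaseCost]
        gcongr
        omega
      have hshift : ∀ q, r + (q + 1) = r + 1 + q := fun q => by ring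
      rw [hshift] at hF
      have := ih (r + 1) hF hσ'
      simp only [← hshift] at this
      refine le_trans (failure_mono _ ?_) this
      rintro o c' ⟨ho, hc''⟩
      exact ⟨ho, by omega⟩
    · exact (failure_run_of_length_le hσ (by omega) _ δ).trans
        (Finset.sum_nonneg fun q _ => hε0 _)

end Equilibrium

/-! ### Summing errors and costs over the phases. -/

namespace Equilibrium

open Strategy

/-- With y = nm(r + 2)/δ, the repetitions give an error of at most y⁻¹⁰. Two powers of y pay for the
factors `n + m` and `rounds n m` and leave (δ/(r + 2))²; the other eight absorb the constants, as y
≥ 2. -/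
lemma failure_phase_bound_le {n m : ℕ} (hn : 0 < n) (hm : 0 < m) {δ : ℝ} (h0 : 0 < δ) (h1 : δ < 1)
    (r : ℕ) : (n + m : ℝ) * ((1 + 4 * rounds n m) * (9 / 10) ^ reps n m δ r)
      ≤ δ / ((r + 1) * (r + 2)) := by
  have hn' : (1 : ℝ) ≤ n := by exact_mod_cast hn
  have hm' : (1 : ℝ) ≤ m := by exact_mod_cast hm
  obtain ⟨z, hz⟩ : ∃ z : ℝ, z = n * m := ⟨_, rfl⟩
  have hz1 : 1 ≤ z := by rw [hz]; nlinarith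
  have hsum : (n + m : ℝ) ≤ 2 * z := by rw [hz]; nlinarith
  have hK : (1 + 4 * rounds n m : ℝ) ≤ 41 * z := by
    have : Nat.log 2 (n * m) ≤ n * m := Nat.log_le_self _ _
    have : ((Nat.log 2 (n * m) : ℕ) : ℝ) ≤ z := by rw [hz]; exact_mod_cast this
    unfold rounds
    push_cast
    linarith
  have hr : (0 : ℝ) ≤ r := Nat.cast_nonneg r
  set y : ℝ := n * m * (r + 2) / δ with hy
  have hyz : z * (r + 2) ≤ y := by
    rw [hy, ← hz, le_div_iff₀ h0]
    have : 0 ≤ z * (r + 2) := by positivity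
    nlinarith
  have hyδ : z * (r + 2) = y * δ := by rw [hy, ← hz]; field_simp
  have hy2 : 2 ≤ y := by nlinarith
  have hy0 : 0 < y := by linarith
  have hpow : (9 / 10 : ℝ) ^ reps n m δ r ≤ (y⁻¹) ^ 10 := by
    have ht : 100 * Real.log y ≤ reps n m δ r := by
      unfold reps
      push_cast
      linarith [Nat.le_ceil (100 * Real.log y)]
    have h9 : (9 / 10 : ℝ) ≤ Real.exp (-(1 / 10)) := by
      have := Real.add_one_le_exp (-(1 / 10) : ℝ)
      linarith
    calc (9 / 10 : ℝ) ^ reps n m δ r ≤ Real.exp (-(1 / 10)) ^ reps n m δ r := by gcongr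
      _ = Real.exp (reps n m δ r * -(1 / 10)) := by rw [Real.exp_nat_mul]
      _ ≤ Real.exp ((10 : ℕ) * -Real.log y) := Real.exp_le_exp.2 (by push_cast; linarith)
      _ = (y⁻¹) ^ 10 := by rw [Real.exp_nat_mul, Real.exp_neg, Real.exp_log hy0]
  have hinv : (y⁻¹) ^ 10 ≤ (y⁻¹) ^ 2 * (1 / 256) := by
    have h8 : (y⁻¹) ^ 8 ≤ (2⁻¹) ^ 8 := by gcongr
    calc (y⁻¹) ^ 10 = (y⁻¹) ^ 2 * (y⁻¹) ^ 8 := by ring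
      _ ≤ (y⁻¹) ^ 2 * (2⁻¹) ^ 8 := by gcongr
      _ = _ := by norm_num
  calc (n + m : ℝ) * ((1 + 4 * rounds n m) * (9 / 10) ^ reps n m δ r)
      ≤ (2 * z) * ((41 * z) * ((y⁻¹) ^ 2 * (1 / 256))) := by
        gcongr
        exact hpow.trans hinv
    _ = 82 / 256 * (z / y) ^ 2 := by field_simp; ring
    _ = 82 / 256 * (δ / (r + 2)) ^ 2 := by
        congr 2
        rw [div_eq_div_iff hy0.ne' (by positivity)]
        linarith
    _ ≤ 1 * (δ / ((r + 1) * (r + 2))) := by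
        gcongr ?_ * ?_
        · norm_num
        · rw [div_pow, div_le_div_iff₀ (by positivity) (by positivity)]
          have e1 : δ ^ 2 ≤ δ := by nlinarith
          have e2 : ((r : ℝ) + 1) * (r + 2) ≤ (r + 2) ^ 2 := by nlinarith
          exact mul_le_mul e1 e2 (by positivity) h0.le
    _ = _ := one_mul _

/-- The sum telescopes, so the error budgets of all phases fit into `δ`. -/
lemma sum_div_succ_mul_le {δ : ℝ} (h0 : 0 ≤ δ) (F : ℕ) :
    ∑ r ∈ Finset.range F, δ / (((r : ℝ) + 1) * (r + 2)) ≤ δ := by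
  have h : ∑ r ∈ Finset.range F, δ / (((r : ℝ) + 1) * (r + 2)) = δ - δ / (F + 1) := by
    induction F with
    | zero => simp
    | succ F ih =>
      rw [Finset.sum_range_succ, ih]
      push_cast
      field_simp
      ring
  rw [h]
  have : 0 ≤ δ / ((F : ℝ) + 1) := by positivity
  linarith

/-- Rounding up costs 1 ≤ 4 / w², because w ≤ 2. -/
lemma samples_le (r : ℕ) : (samples r : ℝ) ≤ 164 / width r ^ 2 := by
  have hw := width_pos r
  have hw2 : width r ≤ 2 := by
    unfold width
    have : (3 / 4 : ℝ) ^ r ≤ 1 := pow_le_one₀ (by norm_num) (by norm_num)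
    linarith
  have h1 := (Nat.ceil_lt_add_one (by positivity : 0 ≤ 160 / width r ^ 2)).le
  refine h1.trans ?_
  rw [div_add_one (by positivity)]
  gcongr
  nlinarith

lemma sum_inv_sq_width_le (F : ℕ) :
    ∑ r ∈ Finset.range (F + 1), 1 / width r ^ 2 ≤ 16 / 7 * (1 / width F ^ 2) := by
  induction F with
  | zero => simp [width]; norm_num
  | succ F ih =>
    have hw := width_pos F
    rw [Finset.sum_range_succ]
    have : 1 / width (F + 1) ^ 2 = 16 / 9 * (1 / width F ^ 2) := by
      rw [width_succ]; field_simp; norm_num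
    rw [this]
    linarith

/-- The last phase with `g < 5 * width r` dominates the geometric sum, and 164 · (16/7) · 25 < 9372.
-/
lemma sum_near_samples_le {g : ℝ} (hg : 0 < g) (F : ℕ) :
    ∑ r ∈ Finset.range F, (if g < 5 * width r then (samples r : ℝ) else 0) ≤ 9372 * (1 / g ^ 2) := by
  induction F with
  | zero => simp; positivity
  | succ F ih =>
    by_cases h : g < 5 * width F
    · have hw := width_pos F
      have h1 : 1 / width F ^ 2 ≤ 25 * (1 / g ^ 2) := by
        rw [mul_one_div, div_le_div_iff₀ (by positivity) (by positivity)]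
        nlinarith
      calc _ ≤ ∑ r ∈ Finset.range (F + 1), 164 * (1 / width r ^ 2) := by
            refine Finset.sum_le_sum fun r _ => ?_
            split_ifs
            · rw [mul_one_div]; exact samples_le r
            · positivity
        _ ≤ 164 * (16 / 7 * (1 / width F ^ 2)) := by
            rw [← Finset.mul_sum]
            exact mul_le_mul_of_nonneg_left (sum_inv_sq_width_le F) (by norm_num)
        _ ≤ 9372 * (1 / g ^ 2) := by
            have : 0 ≤ 1 / g ^ 2 := by positivity
            linarith
    · rw [Finset.sum_range_succ, if_neg h, add_zero]
      exact ih

section Hardness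

variable {n m : ℕ} {A : Matrix (Fin n) (Fin m) ℝ} {i₀ : Fin n} {j₀ : Fin m}

lemma sum_near_mul_samples_le (hA : IsStrictPSNE A i₀ j₀) (F : ℕ) :
    ∑ r ∈ Finset.range F, ((nearRows A i₀ j₀ (width r) + nearCols A i₀ j₀ (width r) : ℕ) : ℝ)
      * samples r ≤ 9372 * hardness A i₀ j₀ := by
  have key : ∀ {k : ℕ} (s : Finset (Fin k)) (g : Fin k → ℝ), (∀ i ∈ s, 0 < g i) →
      ∑ r ∈ Finset.range F, ((s.filter fun i => g i < 5 * width r).card : ℝ) * samples r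
        ≤ 9372 * ∑ i ∈ s, 1 / g i ^ 2 := by
    intro k s g hg
    calc _ = ∑ i ∈ s, ∑ r ∈ Finset.range F,
          (if g i < 5 * width r then (samples r : ℝ) else 0) := by
          rw [Finset.sum_comm]
          refine Finset.sum_congr rfl fun r _ => ?_
          rw [← Finset.sum_filter, Finset.sum_const, nsmul_eq_mul]
      _ ≤ ∑ i ∈ s, 9372 * (1 / g i ^ 2) :=
          Finset.sum_le_sum fun i hi => sum_near_samples_le (hg i hi) F
      _ = _ := by rw [Finset.mul_sum]
  have h1 := key (Finset.univ.erase i₀) (fun i => A i₀ j₀ - A i j₀) fun i hi =>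
    sub_pos.2 (hA.1 i (Finset.ne_of_mem_erase hi))
  have h2 := key (Finset.univ.erase j₀) (fun j => A i₀ j - A i₀ j₀) fun j hj =>
    sub_pos.2 (hA.2 j (Finset.ne_of_mem_erase hj))
  calc _ = (∑ r ∈ Finset.range F, (nearRows A i₀ j₀ (width r) : ℝ) * samples r)
        + ∑ r ∈ Finset.range F, (nearCols A i₀ j₀ (width r) : ℝ) * samples r := by
        rw [← Finset.sum_add_distrib]
        refine Finset.sum_congr rfl fun r _ => ?_
        push_cast; ring
    _ ≤ _ := by
        unfold hardness nearRows nearCols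
        rw [mul_add]
        exact add_le_add h1 h2

lemma hardness_nonneg : 0 ≤ hardness A i₀ j₀ := by
  unfold hardness
  positivity

/-- A single term 1/g² is at most the hardness, so every gap is at least `5 * w`. -/
lemma near_eq_zero (hA : IsStrictPSNE A i₀ j₀) {w : ℝ} (hw : 0 < w)
    (h : (5 * w) ^ 2 * hardness A i₀ j₀ ≤ 1) :
    nearRows A i₀ j₀ w + nearCols A i₀ j₀ w = 0 := by
  have key : ∀ g : ℝ, 0 < g → 1 / g ^ 2 ≤ hardness A i₀ j₀ → ¬ g < 5 * w := by
    intro g hg hle hlt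
    have h1 : g ^ 2 < (5 * w) ^ 2 := by gcongr
    have h2 : (5 * w) ^ 2 * (1 / g ^ 2) ≤ 1 := by
      refine le_trans ?_ h
      gcongr
    rw [mul_one_div, div_le_one (by positivity)] at h2
    linarith
  have hr : ∀ i ∈ Finset.univ.erase i₀, 1 / (A i₀ j₀ - A i j₀) ^ 2 ≤ hardness A i₀ j₀ := by
    intro i hi
    have h1 := Finset.single_le_sum (f := fun i => 1 / (A i₀ j₀ - A i j₀) ^ 2)
      (fun i _ => by positivity) hi
    refine h1.trans (le_add_of_nonneg_right ?_)
    positivity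
  have hc : ∀ j ∈ Finset.univ.erase j₀, 1 / (A i₀ j - A i₀ j₀) ^ 2 ≤ hardness A i₀ j₀ := by
    intro j hj
    have h1 := Finset.single_le_sum (f := fun j => 1 / (A i₀ j - A i₀ j₀) ^ 2)
      (fun j _ => by positivity) hj
    refine h1.trans (le_add_of_nonneg_left ?_)
    positivity
  unfold nearRows nearCols
  rw [Finset.filter_false_of_mem fun i hi => key _
      (sub_pos.2 (hA.1 i (Finset.ne_of_mem_erase hi))) (hr i hi),
    Finset.filter_false_of_mem fun j hj => key _
      (sub_pos.2 (hA.2 j (Finset.ne_of_mem_erase hj))) (hc j hj)]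
  rfl

/-- The number of phases. -/
noncomputable def phases (H : ℝ) : ℕ := ⌈2 * Real.log (100 * H)⌉₊

/-- The squared width decays like (9/16)^F, and √e ≤ 16/9 explains the factor 2 in `phases`. -/
lemma width_phases_sq_mul_le {H : ℝ} (hH : 0 ≤ H) : (5 * width (phases H)) ^ 2 * H ≤ 1 := by
  rcases hH.eq_or_lt with rfl | hH
  · simp
  set F := phases H with hF
  have h1 : 2 * Real.log (100 * H) ≤ F := Nat.le_ceil _
  have h2 : (100 * H) ≤ (16 / 9) ^ F := by
    have h3 : Real.exp (1 / 2) ≤ 16 / 9 := by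
      have h4 : Real.exp (1 / 2) ^ 2 ≤ (16 / 9) ^ 2 := by
        rw [← Real.exp_nat_mul]
        have := Real.exp_one_lt_d9
        norm_num at this ⊢
        linarith
      exact le_of_sq_le_sq h4 (by norm_num)
    calc 100 * H = Real.exp (Real.log (100 * H)) := (Real.exp_log (by positivity)).symm
      _ ≤ Real.exp (F * (1 / 2)) := by gcongr; linarith
      _ = Real.exp (1 / 2) ^ F := by rw [Real.exp_nat_mul]
      _ ≤ _ := by gcongr
  have h5 : (5 * width F) ^ 2 = 100 * (1 / (16 / 9) ^ F) := by
    have : (1 : ℝ) / (16 / 9) ^ F = ((3 / 4) ^ F) ^ 2 := by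
      rw [← pow_mul, mul_comm, pow_mul, one_div, ← inv_pow]
      norm_num
    rw [this, width]
    ring
  rw [h5, mul_one_div, div_mul_eq_mul_div, div_le_one (by positivity)]
  exact h2

lemma phases_le {H : ℝ} : (phases H : ℝ) ≤ 13 * max 1 (Real.log H) := by
  set M := max 1 (Real.log H) with hM
  have hM1 : 1 ≤ M := le_max_left _ _
  have hlog : Real.log (100 * H) ≤ 5 + M := by
    by_cases hH : H = 0
    · simp [hH]; linarith
    · rw [Real.log_mul (by norm_num) hH]
      have : Real.log 100 ≤ 5 := by
        rw [Real.log_le_iff_le_exp (by norm_num)]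
        exact hundred_le_exp_five
      exact add_le_add this (le_max_right _ _)
  have h1 : phases H ≤ ⌈2 * (5 + M)⌉₊ := Nat.ceil_mono (by linarith)
  have h2 := (Nat.ceil_lt_add_one (by linarith : 0 ≤ 2 * (5 + M))).le
  have h3 : (phases H : ℝ) ≤ ⌈2 * (5 + M)⌉₊ := by exact_mod_cast h1
  linarith

lemma reps_mono {δ : ℝ} (hn : 0 < n) (hm : 0 < m) (h0 : 0 < δ) {r r' : ℕ} (h : r ≤ r') :
    reps n m δ r ≤ reps n m δ r' := by
  unfold reps
  have : (r : ℝ) ≤ r' := by exact_mod_cast h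
  gcongr

/-- Here `phases H + 2` is at most 16 · max(1, log H). The resulting `4 * Real.log 2` and the
roundings are absorbed because the logarithm on the right is at least log 2. -/
lemma reps_phases_le {δ H : ℝ} (hnm : 2 ≤ n * m) (h0 : 0 < δ) (h1 : δ < 1) :
    (reps n m δ (phases H) : ℝ)
      ≤ 503 * Real.log ((n : ℝ) * m * max 1 (Real.log H) / δ) := by
  set M := max 1 (Real.log H) with hM
  have hM1 : 1 ≤ M := le_max_left _ _
  have hz : (2 : ℝ) ≤ n * m := by exact_mod_cast hnm
  have hy : 2 ≤ (n : ℝ) * m * M / δ := by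
    rw [le_div_iff₀ h0]
    nlinarith
  have hL : Real.log 2 ≤ Real.log ((n : ℝ) * m * M / δ) := Real.log_le_log (by norm_num) hy
  have hF := phases_le (H := H)
  have hlog : Real.log ((n : ℝ) * m * (phases H + 2) / δ)
      ≤ 4 * Real.log 2 + Real.log ((n : ℝ) * m * M / δ) := by
    have h16 : 4 * Real.log 2 = Real.log 16 := by
      rw [show (16 : ℝ) = 2 ^ 4 by norm_num, Real.log_pow]; norm_num
    rw [h16, ← Real.log_mul (by norm_num) (by linarith)]
    apply Real.log_le_log
    · have : (0 : ℝ) ≤ phases H := Nat.cast_nonneg _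
      positivity
    · rw [← mul_div_assoc]
      refine div_le_div_of_nonneg_right ?_ h0.le
      calc (n : ℝ) * m * (phases H + 2) ≤ n * m * (16 * M) := by gcongr; linarith
        _ = _ := by ring
  have hlog2 := Real.log_two_gt_d9
  have hpos : 0 ≤ 100 * Real.log ((n : ℝ) * m * (phases H + 2) / δ) := by
    have : 1 ≤ (n : ℝ) * m * (phases H + 2) / δ := by
      rw [le_div_iff₀ h0]
      have : (0 : ℝ) ≤ phases H := Nat.cast_nonneg _
      nlinarith
    have := Real.log_nonneg this
    positivity
  have h2 := (Nat.ceil_lt_add_one hpos).le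
  unfold reps
  push_cast
  linarith

lemma one_add_rounds_le (hnm : 2 ≤ n * m) :
    (1 + 32 * rounds n m : ℝ) ≤ 495 * Real.log ((n : ℝ) * m) := by
  have hz : (2 : ℝ) ≤ n * m := by exact_mod_cast hnm
  have h1 : Real.log 2 ≤ Real.log ((n : ℝ) * m) := Real.log_le_log (by norm_num) hz
  have h2 : (Nat.log 2 (n * m) : ℝ) * Real.log 2 ≤ Real.log ((n : ℝ) * m) := by
    rw [← Real.log_pow]
    refine Real.log_le_log (by positivity) ?_
    exact_mod_cast Nat.pow_log_le_self 2 (by omega)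
  have hlog2 := Real.log_two_gt_d9
  have h3 : (Nat.log 2 (n * m) : ℝ) ≤ 1.4427 * Real.log ((n : ℝ) * m) := by
    have h0 : (0 : ℝ) ≤ Nat.log 2 (n * m) := Nat.cast_nonneg _
    nlinarith
  unfold rounds
  push_cast
  linarith

lemma sum_phaseCost_le [NeZero n] [NeZero m] (hA : IsStrictPSNE A i₀ j₀) {δ : ℝ} (h0 : 0 < δ)
    (h1 : δ < 1) :
    ((∑ q ∈ Finset.range (phases (hardness A i₀ j₀)), phaseCost A i₀ j₀ δ (0 + q) : ℕ) : ℝ)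
      ≤ 10 ^ 10 * hardness A i₀ j₀
        * Real.log ((n : ℝ) * m * max 1 (Real.log (hardness A i₀ j₀)) / δ)
        * Real.log ((n : ℝ) * m) := by
  set H := hardness A i₀ j₀ with hH
  have hH0 : 0 ≤ H := hardness_nonneg
  have hn := NeZero.pos n
  have hm := NeZero.pos m
  have hmain : ((∑ q ∈ Finset.range (phases H), phaseCost A i₀ j₀ δ (0 + q) : ℕ) : ℝ)
      ≤ 4 * (reps n m δ (phases H) : ℝ) * (1 + 32 * rounds n m) * (9372 * H) := by
    refine le_trans ?_ (mul_le_mul_of_nonneg_left (sum_near_mul_samples_le hA (phases H))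
      (by positivity))
    push_cast
    rw [Finset.mul_sum]
    refine Finset.sum_le_sum fun q hq => ?_
    have hle : (reps n m δ q : ℝ) ≤ reps n m δ (phases H) := by
      exact_mod_cast reps_mono hn hm h0 (Finset.mem_range.1 hq).le
    rw [zero_add, phaseCost]
    push_cast
    calc _ = 4 * (reps n m δ q : ℝ) * (1 + 32 * rounds n m) *
          ((nearRows A i₀ j₀ (width q) + nearCols A i₀ j₀ (width q)) * samples q) := by ring
      _ ≤ _ := by gcongr
  -- For a single entry log(nm) = 0, so no constant could be absorbed; but then the hardness and the
  -- cost vanish too.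
  rcases Nat.lt_or_ge (n * m) 2 with hnm | hnm
  · have hnm1 : n * m = 1 := by
      have := Nat.mul_pos hn hm
      omega
    obtain ⟨rfl, rfl⟩ : n = 1 ∧ m = 1 := by simpa using hnm1
    have hH1 : H = 0 := by
      rw [hH, hardness, Finset.sum_eq_zero fun i hi =>
        absurd (Subsingleton.elim i i₀) (Finset.ne_of_mem_erase hi),
        Finset.sum_eq_zero fun j hj =>
        absurd (Subsingleton.elim j j₀) (Finset.ne_of_mem_erase hj), add_zero]
    rw [hH1] at hmain ⊢
    simpa using hmain
  · have h2 := reps_phases_le (H := H) hnm h0 h1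
    have h3 := one_add_rounds_le hnm
    set Lg := Real.log ((n : ℝ) * m * max 1 (Real.log H) / δ)
    set Ln := Real.log ((n : ℝ) * m)
    have hLg : 0 ≤ Lg := by
      have : (0 : ℝ) ≤ reps n m δ (phases H) := Nat.cast_nonneg _
      linarith
    have hLn : 0 ≤ Ln := by
      have : (0 : ℝ) ≤ rounds n m := Nat.cast_nonneg _
      linarith
    calc _ ≤ _ := hmain
      _ ≤ 4 * (503 * Lg) * (495 * Ln) * (9372 * H) := by gcongr
      _ = 4 * 503 * 495 * 9372 * (H * Lg * Ln) := by ring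
      _ ≤ 10 ^ 10 * (H * Lg * Ln) := by
        gcongr
        norm_num
      _ = _ := by ring

/-- The initial width is 2 and no gap exceeds 2, so all other rows and columns are near. -/
lemma invariant_init [NeZero n] [NeZero m] (hA01 : ∀ i j, A i j ∈ Set.Icc (-1 : ℝ) 1) :
    Invariant A i₀ j₀ 0 (List.finRange n, List.finRange m, -1) where
  nodup_rows := List.nodup_finRange n
  nodup_cols := List.nodup_finRange m
  mem_rows := List.mem_finRange i₀
  mem_cols := List.mem_finRange j₀
  lower_le := (hA01 i₀ j₀).1
  le_upper := by
    have := (hA01 i₀ j₀).2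
    simp only [width]
    linarith
  rows_lt := by
    have hn := NeZero.pos n
    unfold nearRows
    rw [Finset.filter_true_of_mem fun i _ => ?_, Finset.card_erase_of_mem (Finset.mem_univ _)]
    · simp only [List.length_finRange, Finset.card_univ, Fintype.card_fin]
      omega
    · have h1 := (hA01 i₀ j₀).2
      have h2 := (hA01 i j₀).1
      simp only [width]
      linarith
  cols_lt := by
    have hm := NeZero.pos m
    unfold nearCols
    rw [Finset.filter_true_of_mem fun j _ => ?_, Finset.card_erase_of_mem (Finset.mem_univ _)]
    · simp only [List.length_finRange, Finset.card_univ, Fintype.card_fin]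
      omega
    · have h1 := (hA01 i₀ j₀).1
      have h2 := (hA01 i₀ j).2
      simp only [width]
      linarith

lemma probReturnsWithin_mono {L : Learner n m} {Ω : Type*} [MeasurableSpace Ω] {μ : Measure Ω}
    [IsProbabilityMeasure μ] {X : Fin n × Fin m → ℕ → Ω → ℝ} {b : Fin n × Fin m} {N N' : ℝ}
    (h : N ≤ N') : L.probReturnsWithin μ X b N ≤ L.probReturnsWithin μ X b N' :=
  measureReal_mono fun _ ⟨t, h1, h2⟩ => ⟨t, h1, h2.trans h⟩

theorem one_sub_le_probReturnsWithin [NeZero n] [NeZero m] {δ : ℝ} (h0 : 0 < δ) (h1 : δ < 1)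
    (hA01 : ∀ i j, A i j ∈ Set.Icc (-1 : ℝ) 1) (hA : IsStrictPSNE A i₀ j₀)
    {Ω : Type*} [MeasurableSpace Ω] {μ : Measure Ω} [IsProbabilityMeasure μ]
    {X : Fin n × Fin m → ℕ → Ω → ℝ} (hX : IsNoisySampling A μ X) :
    1 - δ ≤ (Learner.ofStrategies (algorithm n m δ)).probReturnsWithin μ X (i₀, j₀)
      (10 ^ 10 * hardness A i₀ j₀
        * Real.log ((n : ℝ) * m * max 1 (Real.log (hardness A i₀ j₀)) / δ)
        * Real.log ((n : ℝ) * m)) := by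
  set F := phases (hardness A i₀ j₀) with hF
  set p : Option (Fin n × Fin m) → ℕ → Prop := fun o c =>
    o = some (i₀, j₀) ∧ c ≤ ∑ q ∈ Finset.range F, phaseCost A i₀ j₀ δ (0 + q) with hp
  have hfail : (algorithm n m δ (F + 1)).failure (fun e => A e.1 e.2) p ≤ δ := by
    refine (failure_run_le hA (fun r => δ / (((r : ℝ) + 1) * (r + 2)))
      (failure_phase_bound_le (NeZero.pos n) (NeZero.pos m) h0 h1) F 0 ?_
      (invariant_init hA01)).trans ?_
    · rw [zero_add]
      exact near_eq_zero hA (width_pos _) (width_phases_sq_mul_le hardness_nonneg)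
    · simp only [zero_add]
      exact sum_div_succ_mul_le h0.le F
  have hsource := hX.isSource
  have hbad := hsource.measureReal_not_le_failure (algorithm n m δ (F + 1)) p 0 0
  have hmeas := iSup₂_le (fun i (_ : i ∈ unused 0 0) => hsource.le i) _
    (hsource.measurableSet_not (algorithm n m δ (F + 1)) p 0 0)
  have hcompl := probReal_compl_eq_one_sub (μ := μ.prod coinLaw) hmeas
  refine le_trans (by linarith) (hcompl.ge.trans ?_)
  refine measureReal_mono (μ := μ.prod coinLaw) fun ω hω => ?_
  simp only [Set.mem_compl_iff, Set.mem_ofPred_eq, not_not] at hω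
  refine Learner.returnsWithin_ofStrategies isPhased_algorithm ω.2 (fun a k => X a k ω.1) hω.1 ?_
  refine le_trans ?_ (sum_phaseCost_le hA h0 h1)
  exact_mod_cast hω.2

end Hardness

end Equilibrium

/-! ### Dueling bandits. -/

lemma ProbabilityTheory.HasSubgaussianMGF.mono {Ω : Type*} {mΩ : MeasurableSpace Ω} {μ : Measure Ω}
    {Y : Ω → ℝ} {c c' : NNReal} (h : HasSubgaussianMGF Y c μ) (hc : c ≤ c') :
    HasSubgaussianMGF Y c' μ where
  integrable_exp_mul := h.integrable_exp_mul
  mgf_le t := (h.mgf_le t).trans (by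
    have : (c : ℝ) ≤ c' := by exact_mod_cast hc
    gcongr)

section Duel

variable {K : ℕ} {P : Matrix (Fin K) (Fin K) ℝ} {i₀ : Fin K}

/-- Hoeffding's lemma gives variance proxy 1/4 for outcomes in [0, 1]. -/
lemma IsDuelSampling.isNoisySampling {Ω : Type*} [MeasurableSpace Ω] {μ : Measure Ω}
    [IsProbabilityMeasure μ] {X : Fin K × Fin K → ℕ → Ω → ℝ} (h : IsDuelSampling P μ X) :
    IsNoisySampling P μ X := by
  have hIcc : ∀ a k, ∀ᵐ ω ∂μ, X a k ω ∈ Set.Icc (0 : ℝ) 1 := fun a k => by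
    filter_upwards with ω
    rcases h.outcome a k ω with h | h <;> simp [h]
  have hmean : ∀ a k, ∫ ω, X a k ω ∂μ = P a.1 a.2 := by
    intro a k
    have hm : MeasurableSet {ω | X a k ω = 1} := h.measurable a k (measurableSet_singleton 1)
    have heq : X a k = Set.indicator {ω | X a k ω = 1} fun _ => (1 : ℝ) := by
      funext ω
      rcases h.outcome a k ω with h | h <;> simp [Set.indicator, h]
    rw [heq, integral_indicator_const _ hm, ← h.prob a k]
    simp
  refine ⟨h.measurable, h.indep, fun a k => ?_, fun a k => ?_⟩
  · rw [integral_sub (Integrable.of_mem_Icc 0 1 (h.measurable a k).aemeasurable (hIcc a k))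
      (integrable_const _), hmean]
    simp
  · have := hasSubgaussianMGF_of_mem_Icc (h.measurable a k).aemeasurable (hIcc a k)
    rw [hmean] at this
    refine this.mono ?_
    rw [← NNReal.coe_le_coe]
    norm_num

lemma IsPreferenceMatrix.diag (hP : IsPreferenceMatrix P) (i : Fin K) : P i i = 1 / 2 := by
  linarith [hP.2 i i]

lemma IsCondorcetWinner.isStrictPSNE (hP : IsPreferenceMatrix P) (h : IsCondorcetWinner P i₀) :
    IsStrictPSNE P i₀ i₀ := by
  refine ⟨fun i hi => ?_, fun j hj => ?_⟩
  · linarith [hP.2 i i₀, h i hi, hP.diag i₀]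
  · linarith [h j hj, hP.diag i₀]

lemma IsPreferenceMatrix.hardness_eq (hP : IsPreferenceMatrix P) :
    hardness P i₀ i₀ = 2 * duelHardness P i₀ := by
  unfold hardness duelHardness
  rw [two_mul, hP.diag i₀]
  congr 1
  refine Finset.sum_congr rfl fun i _ => ?_
  have : P i i₀ = 1 - P i₀ i := by linarith [hP.2 i i₀]
  rw [this]
  ring_nf

/-- Gaps are at most 1/2. This makes log H ≥ 1, so the duel bound needs no maximum with 1. -/
lemma IsCondorcetWinner.four_le_duelHardness (hP : IsPreferenceMatrix P)
    (h : IsCondorcetWinner P i₀) (hK : 2 ≤ K) : 4 ≤ duelHardness P i₀ := by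
  have : Nontrivial (Fin K) := Fin.nontrivial_iff_two_le.2 hK
  obtain ⟨i, hi⟩ := exists_ne i₀
  have h1 := Finset.single_le_sum (f := fun i => 1 / (P i₀ i - 1 / 2) ^ 2)
    (fun i _ => by positivity) (Finset.mem_erase.2 ⟨hi, Finset.mem_univ i⟩)
  refine le_trans ?_ h1
  have h2 : 0 < P i₀ i - 1 / 2 := by linarith [h i hi]
  have h3 := (hP.1 i₀ i).2
  rw [le_div_iff₀ (by positivity)]
  nlinarith

lemma duel_bound_le {δ H : ℝ} (hK : 2 ≤ K) (hH : 4 ≤ H) (h0 : 0 < δ) (h1 : δ < 1) :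
    10 ^ 10 * (2 * H) * Real.log ((K : ℝ) * K * max 1 (Real.log (2 * H)) / δ)
        * Real.log ((K : ℝ) * K)
      ≤ 10 ^ 12 * H * Real.log ((K : ℝ) * Real.log H / δ) * Real.log K := by
  have hK' : (2 : ℝ) ≤ K := by exact_mod_cast hK
  have hlog2 := Real.log_two_gt_d9
  have hl4 : Real.log 4 = 2 * Real.log 2 := by
    rw [show (4 : ℝ) = 2 ^ 2 by norm_num, Real.log_pow]; norm_num
  have hlH : Real.log 4 ≤ Real.log H := Real.log_le_log (by norm_num) hH
  have hl1 : 1 ≤ Real.log H := by linarith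
  have hmax : max 1 (Real.log (2 * H)) ≤ 2 * Real.log H := by
    refine max_le (by linarith) ?_
    rw [Real.log_mul (by norm_num) (by linarith)]
    linarith
  set l := Real.log H
  set z := (K : ℝ) * l / δ with hz
  have hlogK : 0 ≤ Real.log (K : ℝ) := Real.log_nonneg (by linarith)
  have hz1 : (K : ℝ) * l ≤ z := by
    rw [hz, le_div_iff₀ h0]
    have : 0 ≤ (K : ℝ) * l := by positivity
    nlinarith
  have hz2 : 2 ≤ z := by nlinarith
  have hzlog : 0 ≤ Real.log z := Real.log_nonneg (by linarith)
  -- Both `K` and 2 are at most `z`, so the larger argument of the logarithm costs only a factor 3.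
  have hcube : (K : ℝ) * K * max 1 (Real.log (2 * H)) / δ ≤ z ^ 3 := by
    calc (K : ℝ) * K * max 1 (Real.log (2 * H)) / δ ≤ K * K * (2 * l) / δ := by gcongr
      _ = (K * 2) * z := by rw [hz]; ring
      _ ≤ (z * z) * z := by
        have hKz : (K : ℝ) ≤ z := le_trans (by nlinarith) hz1
        gcongr
      _ = z ^ 3 := by ring
  have hL : Real.log ((K : ℝ) * K * max 1 (Real.log (2 * H)) / δ) ≤ 3 * Real.log z := by
    have := Real.log_le_log (by
      have : 0 < max 1 (Real.log (2 * H)) := lt_of_lt_of_le one_pos (le_max_left _ _)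
      positivity) hcube
    rw [Real.log_pow] at this
    exact_mod_cast this
  have hKK : Real.log ((K : ℝ) * K) = Real.log K + Real.log K :=
    Real.log_mul (by linarith) (by linarith)
  rw [hKK]
  calc _ ≤ 10 ^ 10 * (2 * H) * (3 * Real.log z) * (Real.log K + Real.log K) := by gcongr
    _ = 12 * 10 ^ 10 * (H * Real.log z * Real.log K) := by ring
    _ ≤ 10 ^ 12 * (H * Real.log z * Real.log K) := by
      gcongr
      norm_num
    _ = _ := by ring

end Duel

theorem theorem1 :
    ∃ c₀ : ℝ, 0 < c₀ ∧
    -- the algorithm receives the size of the matrix and the error probability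
    ∃ alg : ∀ (n m : ℕ) [NeZero n] [NeZero m], ℝ → Learner n m,
      (∀ (n m : ℕ) [NeZero n] [NeZero m] (δ : ℝ), 0 < δ → δ < 1 →
        ∀ (A : Matrix (Fin n) (Fin m) ℝ), (∀ i j, A i j ∈ Set.Icc (-1 : ℝ) 1) →
        ∀ (i₀ : Fin n) (j₀ : Fin m), IsStrictPSNE A i₀ j₀ →
        ∀ (Ω : Type u) [MeasurableSpace Ω] (μ : Measure Ω) [IsProbabilityMeasure μ]
          (X : Fin n × Fin m → ℕ → Ω → ℝ), IsNoisySampling A μ X →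
        1 - δ ≤ (alg n m δ).probReturnsWithin μ X (i₀, j₀)
          (c₀ * hardness A i₀ j₀
            * Real.log ((n : ℝ) * (m : ℝ) * max 1 (Real.log (hardness A i₀ j₀)) / δ)
            * Real.log ((n : ℝ) * (m : ℝ)))) ∧
      (∀ (K : ℕ) [NeZero K] (δ : ℝ), 0 < δ → δ < 1 →
        ∀ (P : Matrix (Fin K) (Fin K) ℝ), IsPreferenceMatrix P →
        ∀ i₀ : Fin K, IsCondorcetWinner P i₀ →
        ∀ (Ω : Type u) [MeasurableSpace Ω] (μ : Measure Ω) [IsProbabilityMeasure μ]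
          (X : Fin K × Fin K → ℕ → Ω → ℝ), IsDuelSampling P μ X →
        1 - δ ≤ (alg K K δ).probReturnsWithin μ X (i₀, i₀)
          (c₀ * duelHardness P i₀
            * Real.log ((K : ℝ) * Real.log (duelHardness P i₀) / δ)
            * Real.log (K : ℝ))) := by
  refine ⟨10 ^ 12, by norm_num, fun n m _ _ δ =>
    Learner.ofStrategies (Equilibrium.algorithm n m δ), ?_, ?_⟩
  · intro n m _ _ δ h0 h1 A hA01 i₀ j₀ hA Ω _ μ _ X hX
    refine (Equilibrium.one_sub_le_probReturnsWithin h0 h1 hA01 hA hX).trans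
      (Equilibrium.probReturnsWithin_mono ?_)
    have hn : (1 : ℝ) ≤ n := by exact_mod_cast NeZero.pos n
    have hm : (1 : ℝ) ≤ m := by exact_mod_cast NeZero.pos m
    have hnm : (1 : ℝ) ≤ n * m := by nlinarith
    have hH := Equilibrium.hardness_nonneg (A := A) (i₀ := i₀) (j₀ := j₀)
    have hM : 1 ≤ max 1 (Real.log (hardness A i₀ j₀)) := le_max_left _ _
    have hlog : 0 ≤ Real.log ((n : ℝ) * m * max 1 (Real.log (hardness A i₀ j₀)) / δ) := by
      refine Real.log_nonneg ?_
      rw [le_div_iff₀ h0]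
      nlinarith
    have hlog' : 0 ≤ Real.log ((n : ℝ) * m) := Real.log_nonneg hnm
    gcongr <;> norm_num
  · intro K _ δ h0 h1 P hP i₀ hi₀ Ω _ μ _ X hX
    have hP01 : ∀ i j, P i j ∈ Set.Icc (-1 : ℝ) 1 := fun i j =>
      ⟨by linarith [(hP.1 i j).1], (hP.1 i j).2⟩
    refine (Equilibrium.one_sub_le_probReturnsWithin h0 h1 hP01 (hi₀.isStrictPSNE hP)
      hX.isNoisySampling).trans (Equilibrium.probReturnsWithin_mono ?_)
    rw [hP.hardness_eq]
    -- For one arm both bounds are 0, as log 1 = 0.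
    rcases Nat.lt_or_ge K 2 with hK | hK
    · obtain rfl : K = 1 := by
        have := NeZero.pos K
        omega
      simp
    · exact duel_bound_le hK (hi₀.four_le_duelHardness hP hK) h0 h1
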